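/- Consider the infinite spin-$\tfrac12$ chain $\mathbb Z$. For $M\in\mathbb N$ let $\mathcal T_M$ be the complex vector space of traceless translationally invariant operators of maximum range $M$, that is, of formal sums $Q=\sum_{j\in\mathbb Z}q_j$, where $q_j$ is the translate by $j$ of $q_0$, and $q_0$ is a complex linear combination of Pauli strings on the sites $0,\dots,M-1$ with a non-identity letter on site $0$; this representation is unique. Put $\langle Q,Q'\rangle=\mathrm{Tr}[q_0^\dagger q_0']/\mathrm{Tr}[I^{\otimes M}]$ and $\|Q\|_F=\sqrt{\langle Q,Q\rangle}$, let $\mathcal H=\overline{\bigcup_M\mathcal T_M}$ be the Hilbert space completion (the quasi-local operators), and write $\mathrm{ad}_A(O)=[A,O]$, which is defined on $\bigcup_M\mathcal T_M$. Let $H_0\in\mathcal T_1$ and $T\in\mathcal T_2$ be Hermitian with $\|H_0\|_F=\|T\|_F=\Gamma$, let $n\ge1$ and $\rho_n=\frac1{263n^2}$. Write $[k_1,\dots,k_p]=m$ for the conditions $1\le k_i\le n$ and $k_1+\dots+k_p=m$, and let $\mathfrak f(k_1,\dots,k_p)=1/\prod_{l=1}^n\mathrm{card}\{i:k_i=l\}!$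 if $k_1\le\dots\le k_p$, and $0$ otherwise. The generators $S_m$ of the $n$-th order Schrieffer–Wolff transformation are defined recursively by $iS_m=[\mathrm{ad}_{H_0}]^{-1}V_m$, where $[\mathrm{ad}_{H_0}]^{-1}$ is the Moore–Penrose pseudoinverse with respect to $\langle\cdot,\cdot\rangle$, $V_1=T$, and for $m\ge2$ $$V_m=\sum_{p=2}^m\sum_{[k_1,\dots,k_p]=m}\mathfrak f(k_1,\dots,k_p)\,i\mathrm{ad}_{S_{k_p}}\cdots i\mathrm{ad}_{S_{k_1}}(H_0)+\sum_{p=1}^{m-1}\sum_{[k_1,\dots,k_p]=m-1}\mathfrak f(k_1,\dots,k_p)\,i\mathrm{ad}_{S_{k_p}}\cdots i\mathrm{ad}_{S_{k_1}}(T).$$ For $m\ge1$ put $$I_m=\sum_{p=1}^m\sum_{[k_1,\dots,k_p]=m}(-1)^p\,\mathfrak f(k_1,\dots,k_p)\,i\mathrm{ad}_{S_{k_1}}\cdots i\mathrm{ad}_{S_{k_p}}(H_0).$$ For $\varepsilon\in\mathbb R$ let $U=e^{-i\varepsilon S_1}e^{-i\varepsilon^2S_2}\cdots e^{-i\varepsilon^nS_n}$,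 and on the infinite chain let $I=UH_0U^\dagger$ mean the $\|\cdot\|_F$-convergent sum of the product of exponential series $e^{-\varepsilon\,i\mathrm{ad}_{S_1}}\cdots e^{-\varepsilon^n\,i\mathrm{ad}_{S_n}}(H_0)$, i.e. $$I=\sum_{p_1,\dots,p_n\ge0}\ \frac{(-\varepsilon\,i\mathrm{ad}_{S_1})^{p_1}}{p_1!}\cdots\frac{(-\varepsilon^n\,i\mathrm{ad}_{S_n})^{p_n}}{p_n!}(H_0).$$ Then: 1. For every $m\ge1$, $I_m\in\mathcal T_{m+1}$ and $\|I_m\|_F\le\Gamma\rho_n^{-m}$. 2. If $|\varepsilon|/\rho_n\le\frac12$, then the series defining $I=UH_0U^\dagger$ and the series $\sum_{m\ge1}\varepsilon^mI_m$ converge absolutely in $\|\cdot\|_F$, and $$I=H_0+\sum_{m=1}^\infty\varepsilon^mI_m=H_0+\sum_{m=1}^n\varepsilon^mI_m+I_{>n},\qquad I_{>n}=\sum_{m=n+1}^\infty\varepsilon^mI_m,\qquad \|I_{>n}\|_F\le2\Gamma\left(\frac{|\varepsilon|}{\rho_n}\right)^{n+1}.$$ In particular $I$ is quasi-local: it lies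 in the norm closure $\overline{\bigcup_M\mathcal T_M}$, and is the norm limit of the finite-range operators $H_0+\sum_{m=1}^N\varepsilon^mI_m\in\mathcal T_{N+1}$ as $N\to\infty$. -/

import Mathlib

open scoped Nat Pointwise

noncomputable section

namespace SpinChain

/-- Labels of the single-site Pauli operators: `(0,0)`, `(1,0)`, `(1,1)`, `(0,1)` stand for
`I`, `X`, `Y`, `Z`. Adding labels corresponds to multiplying the operators up to a phase. -/
abbrev Letter : Type := ZMod 2 × ZMod 2

/-- The Pauli matrices. -/
def pauli (a : Letter) : Matrix (Fin 2) (Fin 2) ℂ :=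
  if a = (0, 0) then 1
  else if a = (1, 0) then !![0, 1; 1, 0]
  else if a = (1, 1) then !![0, -Complex.I; Complex.I, 0]
  else !![1, 0; 0, -1]

/-- The coefficient of `σ_{a+b}` in the matrix product `σ_a σ_b`. -/
def letterPhase (a b : Letter) : ℂ :=
  (pauli (a + b) * pauli a * pauli b).trace / 2

/-- Pauli strings on the infinite chain `ℤ`: a letter on each site, the identity on all but
finitely many sites. -/
abbrev PString : Type := ℤ →₀ Letter

/-- The phase in the product of Pauli strings `σ_a σ_b = phase a b • σ_{a+b}`. -/
def phase (a b : PString) : ℂ :=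
  ∏ j ∈ a.support ∪ b.support, letterPhase (a j) (b j)

/-- Translation of a Pauli string by `k` sites. -/
def shift (k : ℤ) (a : PString) : PString :=
  Finsupp.equivMapDomain (Equiv.addRight k) a

/-- Gauge-fixed Pauli strings: the first nontrivial letter stands on site `0`. -/
abbrev GString : Type := {a : PString // a 0 ≠ 0 ∧ ∀ j < 0, a j = 0}

/-- Traceless translationally invariant operators of finite range. The element `Q` stands for the
formal sum `∑_{k ∈ ℤ} ∑_a Q(a) τ_k σ_a`, with `τ_k` the translation by `k` sites, written uniquely
through gauge-fixed Pauli strings. -/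
abbrev TIOp : Type := GString →₀ ℂ

/-- The leftmost site of a string is moved to site `0`. -/
theorem shift_leftmost {a : PString} (h : a.support.Nonempty) :
    shift (-(a.support.min' h)) a 0 ≠ 0 ∧
      ∀ j < 0, shift (-(a.support.min' h)) a j = 0 := by
  have key : ∀ j : ℤ, shift (-(a.support.min' h)) a j = a (j + a.support.min' h) := by
    intro j
    simp [shift, Finsupp.equivMapDomain_apply]
  refine ⟨?_, fun j hj => ?_⟩
  · rw [key, zero_add]
    exact Finsupp.mem_support_iff.mp (Finset.min'_mem _ h)
  · rw [key]
    by_contra hne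
    have := Finset.min'_le a.support _ (Finsupp.mem_support_iff.mpr hne)
    omega

/-- The translationally invariant operator `∑_k τ_k σ_a`, for a string `a` standing anywhere on the
chain; the identity string has no traceless part. -/
def gaugeFix (a : PString) : TIOp :=
  if h : a.support.Nonempty then
    Finsupp.single ⟨shift (-(a.support.min' h)) a, shift_leftmost h⟩ 1
  else 0

/-- The commutator `[∑_j τ_j σ_a, ∑_k τ_k σ_b] = ∑_k τ_k (∑_j [τ_j σ_a, σ_b])`. Only the finitely
many `j` for which `τ_j σ_a` and `σ_b` overlap contribute. -/
def bracketString (a b : PString) : TIOp :=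
  ∑ j ∈ b.support - a.support,
    (phase (shift j a) b - phase b (shift j a)) • gaugeFix (shift j a + b)

/-- `ad Q = [Q, ·]` on translationally invariant operators. -/
def ad (Q : TIOp) : Module.End ℂ TIOp :=
  Finsupp.linearCombination ℂ fun b : GString =>
    Q.sum fun a c => c • bracketString a.1 b.1

/-- `i ad_S = i [S, ·]`. -/
def iad (S : TIOp) : Module.End ℂ TIOp := Complex.I • ad S

/-- The space of traceless translationally invariant operators of maximum range `M`. -/
def rangeSpace (M : ℕ) : Submodule ℂ TIOp :=
  Finsupp.supported ℂ ℂ {a : GString | ∀ j : ℤ, (M : ℤ) ≤ j → a.1 j = 0}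

/-- An operator is Hermitian iff its coefficients in the Pauli strings are real. -/
def IsHermitian (Q : TIOp) : Prop := ∀ a, (Q a).im = 0

/-- The Hilbert space of operators of finite intensive Frobenius norm: square-summable coefficients
in the gauge-fixed Pauli strings, which are orthonormal (see `frobInner_eq_trace`). -/
abbrev OpHilbert : Type := lp (fun _ : GString => ℂ) 2

open Classical in
/-- The embedding of the finite-range operators into the Hilbert space. -/
def toHilbert : TIOp →ₗ[ℂ] OpHilbert :=
  Finsupp.linearCombination ℂ fun a : GString => lp.single 2 a (1 : ℂ)

/-- The intensive Frobenius inner product. -/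
def frobInner (Q Q' : TIOp) : ℂ := inner ℂ (toHilbert Q) (toHilbert Q')

/-- The intensive Frobenius norm of a finite-range operator. -/
def frobNorm (Q : TIOp) : ℝ := ‖toHilbert Q‖

/-- The operators of finite range, as a subset of the Hilbert space: the union of the spaces of
maximum range `M`. Its closure consists of the quasi-local operators. -/
def localOps : Set OpHilbert := ⋃ M : ℕ, toHilbert '' (rangeSpace M : Set TIOp)

/-- The matrix of a Pauli string on the sites `0, …, M-1`, a tensor product of Pauli matrices. -/
def windowMatrix (M : ℕ) (a : PString) : Matrix (Fin M → Fin 2) (Fin M → Fin 2) ℂ :=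
  Matrix.of fun s t => ∏ i : Fin M, pauli (a (i : ℕ)) (s i) (t i)

/-- The matrix on the sites `0, …, M-1` of the gauge-fixed local piece `q_0` of `Q = ∑_k q_k`. -/
def density (M : ℕ) (Q : TIOp) : Matrix (Fin M → Fin 2) (Fin M → Fin 2) ℂ :=
  Q.sum fun a c => c • windowMatrix M a.1

theorem letter_cases (a : Letter) : a = (0, 0) ∨ a = (1, 0) ∨ a = (1, 1) ∨ a = (0, 1) := by
  revert a
  decide

theorem pauli_I : pauli (0, 0) = !![1, 0; 0, 1] := by
  rw [pauli, if_pos rfl, Matrix.one_fin_two]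

theorem pauli_X : pauli (1, 0) = !![0, 1; 1, 0] := by
  rw [pauli, if_neg (by decide), if_pos rfl]

theorem pauli_Y : pauli (1, 1) = !![0, -Complex.I; Complex.I, 0] := by
  rw [pauli, if_neg (by decide), if_neg (by decide), if_pos rfl]

theorem pauli_Z : pauli (0, 1) = !![1, 0; 0, -1] := by
  rw [pauli, if_neg (by decide), if_neg (by decide), if_neg (by decide)]

theorem pauli_mul (a b : Letter) : pauli a * pauli b = letterPhase a b • pauli (a + b) := by
  have e : (1 + 1 : ZMod 2) = 0 := rfl
  rcases letter_cases a with rfl | rfl | rfl | rfl <;>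
    rcases letter_cases b with rfl | rfl | rfl | rfl <;>
    simp only [letterPhase, Prod.mk_add_mk, add_zero, zero_add, e, pauli_I, pauli_X, pauli_Y,
      pauli_Z] <;>
    ext i j <;> fin_cases i <;> fin_cases j <;>
    simp [Matrix.trace, Fin.sum_univ_two]

/-- The matrices of Pauli strings multiply with the product of the letter phases. -/
theorem windowMatrix_mul (M : ℕ) (a b : PString) :
    windowMatrix M a * windowMatrix M b =
      (∏ i : Fin M, letterPhase (a (i : ℕ)) (b (i : ℕ))) • windowMatrix M (a + b) := by
  ext s t
  have h : ∀ i : Fin M, ∑ x, pauli (a (i : ℕ)) (s i) x * pauli (b (i : ℕ)) x (t i) =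
      letterPhase (a (i : ℕ)) (b (i : ℕ)) * pauli (a (i : ℕ) + b (i : ℕ)) (s i) (t i) := by
    intro i
    rw [← Matrix.mul_apply, pauli_mul]
    simp
  simp only [windowMatrix, Matrix.mul_apply, Matrix.of_apply, Matrix.smul_apply, smul_eq_mul,
    ← Finset.prod_mul_distrib, Finsupp.add_apply, ← h]
  rw [Finset.prod_univ_sum]
  simp

theorem trace_pauli (a b : Letter) :
    ((pauli a).conjTranspose * pauli b).trace = if a = b then 2 else 0 := by
  rcases letter_cases a with rfl | rfl | rfl | rfl <;>
    rcases letter_cases b with rfl | rfl | rfl | rfl <;>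
    simp [pauli_I, pauli_X, pauli_Y, pauli_Z, Matrix.trace, Fin.sum_univ_two, Matrix.mul_apply] <;>
    norm_num

theorem trace_windowMatrix (M : ℕ) (a b : PString) :
    ((windowMatrix M a).conjTranspose * windowMatrix M b).trace =
      ∏ i : Fin M, (if a (i : ℕ) = b (i : ℕ) then (2 : ℂ) else 0) := by
  simp only [← trace_pauli, windowMatrix, Matrix.trace, Matrix.diag, Matrix.mul_apply,
    Matrix.conjTranspose_apply, Matrix.of_apply, star_prod, ← Finset.prod_mul_distrib]
  rw [Finset.prod_univ_sum, Fintype.piFinset_univ]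
  refine Finset.sum_congr rfl fun s _ => ?_
  rw [Finset.prod_univ_sum, Fintype.piFinset_univ]

theorem frobInner_single (a b : GString) (c d : ℂ) :
    frobInner (Finsupp.single a c) (Finsupp.single b d) =
      if a = b then star c * d else 0 := by
  classical
  simp only [frobInner, toHilbert, Finsupp.linearCombination_single, inner_smul_left,
    inner_smul_right, lp.inner_single_left, lp.single_apply]
  by_cases h : a = b
  · subst h
    simp
    ring
  · simp [h]

/-- The inner product is the normalized trace of the gauge-fixed local pieces. -/
theorem frobInner_eq_trace {M : ℕ} {Q Q' : TIOp} (hQ : Q ∈ rangeSpace M)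
    (hQ' : Q' ∈ rangeSpace M) :
    frobInner Q Q' =
      ((density M Q).conjTranspose * density M Q').trace /
        (1 : Matrix (Fin M → Fin 2) (Fin M → Fin 2) ℂ).trace := by
  classical
  have h1 : frobInner Q Q' = ∑ a ∈ Q.support, ∑ b ∈ Q'.support,
      if a = b then star (Q a) * Q' b else 0 := by
    have e : ∀ R : TIOp, toHilbert R = ∑ a ∈ R.support, toHilbert (Finsupp.single a (R a)) := by
      intro R
      rw [← map_sum]
      exact congrArg _ (Finsupp.sum_single R).symm
    rw [frobInner, e Q, e Q', sum_inner]
    refine Finset.sum_congr rfl fun a _ => ?_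
    rw [inner_sum]
    exact Finset.sum_congr rfl fun b _ => frobInner_single a b _ _
  rw [h1, density, density, Finsupp.sum, Finsupp.sum, Matrix.conjTranspose_sum, Finset.sum_mul,
    Matrix.trace_sum, Finset.sum_div]
  refine Finset.sum_congr rfl fun a ha => ?_
  rw [Finset.mul_sum, Matrix.trace_sum, Finset.sum_div]
  refine Finset.sum_congr rfl fun b hb => ?_
  have ha' := (Finsupp.mem_supported ℂ Q).1 hQ ha
  have hb' := (Finsupp.mem_supported ℂ Q').1 hQ' hb
  rw [Matrix.conjTranspose_smul, Matrix.smul_mul, Matrix.mul_smul, Matrix.trace_smul,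
    Matrix.trace_smul, trace_windowMatrix, Matrix.trace_one]
  by_cases h : a = b
  · subst h
    simp [mul_div_assoc]
  · have : ∃ i : Fin M, a.1 (i : ℕ) ≠ b.1 (i : ℕ) := by
      by_contra hcon
      push Not at hcon
      apply h
      apply Subtype.ext
      ext1 j
      rcases lt_or_ge j 0 with hj | hj
      · rw [a.2.2 j hj, b.2.2 j hj]
      · rcases lt_or_ge j (M : ℤ) with hM | hM
        · lift j to ℕ using hj
          exact hcon ⟨j, by exact_mod_cast hM⟩
        · rw [ha' j hM, hb' j hM]
    obtain ⟨i, hi⟩ := this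
    rw [if_neg h, Finset.prod_eq_zero (Finset.mem_univ i) (if_neg hi)]
    simp

open Classical in
/-- The Moore–Penrose pseudoinverse with respect to the Frobenius inner product: `pinv A y` is the
unique `x` orthogonal to the kernel of `A` such that `y - A x` is orthogonal to the range of `A`. -/
def pinv (A : Module.End ℂ TIOp) (y : TIOp) : TIOp :=
  if h : ∃ x : TIOp, (∀ z, A z = 0 → frobInner z x = 0) ∧ (∀ z, frobInner (A z) (y - A x) = 0)
  then h.choose else 0

/-- The tuples `(k_1, …, k_p)` with `1 ≤ k_i ≤ n` and `k_1 + ⋯ + k_p = m`. -/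
def tuples (n p m : ℕ) : Finset (Fin p → ℕ) :=
  (Fintype.piFinset fun _ => Finset.Icc 1 n).filter fun k => ∑ i, k i = m

open Classical in
/-- The weight of a tuple: zero unless `k_1 ≤ ⋯ ≤ k_p`, and then the inverse of the product of the
factorials of the multiplicities of the values `1, …, n`. -/
def weight (n : ℕ) {p : ℕ} (k : Fin p → ℕ) : ℂ :=
  if Monotone k then
    1 / ((∏ l ∈ Finset.Icc 1 n, (Finset.univ.filter fun i => k i = l).card ! : ℕ) : ℂ)
  else 0

/-- The `m`-th order potential `V_m` of the rotated Hamiltonian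
`e^{iε^n S_n} ⋯ e^{iε S_1} (H₀ + ε T) e^{-iε S_1} ⋯ e^{-iε^n S_n}`, without its part
`i ad_{S_m}(H₀)`, as an expression in the generators; only those `S_k` with `k < m` occur. -/
def potential (n : ℕ) (H₀ T : TIOp) (S : ℕ → TIOp) (m : ℕ) : TIOp :=
  if m = 1 then T
  else
    (∑ p ∈ Finset.Icc 2 m, ∑ k ∈ tuples n p m,
      weight n k • (List.ofFn fun i => iad (S (k i))).reverse.prod H₀) +
    ∑ p ∈ Finset.Icc 1 (m - 1), ∑ k ∈ tuples n p (m - 1),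
      weight n k • (List.ofFn fun i => iad (S (k i))).reverse.prod T

/-- The generators of the `n`-th order Schrieffer–Wolff transformation, determined recursively by
`i S_m = [ad_{H₀}]⁻¹ V_m`. The generators used are `S_1, …, S_n`. -/
def generator (n : ℕ) (H₀ T : TIOp) (m : ℕ) : TIOp :=
  -Complex.I • pinv (ad H₀)
    (potential n H₀ T (fun k => if _h : k < m then generator n H₀ T k else 0) m)
termination_by m

/-- The coefficient `I_m` of `ε^m` in the expansion of `U H₀ U†`. -/
def quasiCoeff (n : ℕ) (H₀ T : TIOp) (m : ℕ) : TIOp :=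
  ∑ p ∈ Finset.Icc 1 m, ∑ k ∈ tuples n p m,
    ((-1 : ℂ) ^ p * weight n k) •
      (List.ofFn fun i => iad (generator n H₀ T (k i))).prod H₀

/-- The term with exponents `p_1, …, p_n` in the expansion of the product of exponential series
`e^{-ε i ad_{S_1}} e^{-ε² i ad_{S_2}} ⋯ e^{-ε^n i ad_{S_n}} X`. -/
def conjTerm (n : ℕ) (S : ℕ → TIOp) (ε : ℝ) (X : TIOp) (p : Fin n → ℕ) : TIOp :=
  (List.ofFn fun l : Fin n =>
    (1 / ((p l)! : ℂ)) • ((-(ε : ℂ) ^ ((l : ℕ) + 1)) • iad (S ((l : ℕ) + 1))) ^ p l).prod X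

/-- `U H₀ U†` for `U = e^{-iε S_1} e^{-iε² S_2} ⋯ e^{-iε^n S_n}` on the infinite chain. Conjugation
by `e^{-iε^l S_l}` is the exponential of the superoperator `-ε^l i ad_{S_l}`; the product of the
exponential series, applied to `H₀`, is summed in the Frobenius norm. -/
def quasiConserved (n : ℕ) (H₀ T : TIOp) (ε : ℝ) : OpHilbert :=
  ∑' p : Fin n → ℕ, toHilbert (conjTerm n (generator n H₀ T) ε H₀ p)

/-- The remainder `I_{>n} = ∑_{m > n} ε^m I_m`. -/
def remainder (n : ℕ) (H₀ T : TIOp) (ε : ℝ) : OpHilbert :=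
  ∑' m : ℕ, ((ε : ℂ) ^ (n + 1 + m)) • toHilbert (quasiCoeff n H₀ T (n + 1 + m))

/-- The lower bound `ρ_n = 1 / (263 n²)` on the convergence radius. -/
def rho (n : ℕ) : ℝ := 1 / (263 * (n : ℝ) ^ 2)

end SpinChain
end

noncomputable section

namespace SpinChain

/-! The Frobenius norm behaves badly under repeated commutators, so the estimates are made in an
atomic norm adapted to `H₀` and translated back only at the end. A nonzero Hermitian one-site `H₀`
is `Γ` times a uniform field along some axis (`exists_eq_smul_field`). In the frame of that axis,
the atoms are translation sums of product operators whose factors are multiples of the raising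
operator, multiples of the lowering operator, or diagonal matrices `α + βZ` with `‖α‖ + ‖β‖ ≤ 1`.
`Decomp U r B Q` says that `Q` is a combination of atoms on `r + 1` neighbouring sites with total
weight at most `B`.

Four facts make this size usable. Factors are closed under multiplication, so the commutator of two
atoms is a signed sum of at most `2 (r + s + 1)` atoms (`Decomp.ad`). Each atom is an eigenvector of
`ad H₀` with eigenvalue in `2Γℤ`, so the pseudoinverse kills it or divides it by at least `2Γ` in
modulus (`Decomp.pinv`). An atom has Frobenius norm at most one (`Decomp.frobNorm_le`). A two-site
`T` has size at most `√30 ‖T‖` by Cauchy–Schwarz (`decomp_of_mem_rangeSpace_two`).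

In a `p`-fold nested commutator the ranges grow linearly, which costs `p!` and a factor `6n` per
generator. Passing from increasing tuples to multiplicities turns the weight into `1 / ∏ (q l)!`,
and with `p!` this is a multinomial coefficient. Summing over all orders therefore gives at most `A
^ p`, where `A` is the generating polynomial of the generator bounds at radius `x`. The recursion
becomes `A_{N+1} ≤ 3n (A_N ^ 2 + √30 x) / (1 - A_N)`; at `x = rho n` the bound `A ≤ 1 / (6n + 2)` is
preserved by it (`majorantSum_rho_le`).

Since then `A ≤ 1/8`, the geometric series in `A` bounds each `I_m` and gives absolute convergence
of the product of exponential series. Regrouping that series by powers of `ε` identifies its sum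
with the series of the `I_m`, whose tail is geometric. -/

/-! ### Translations, phases and gauge fixing of Pauli strings -/

theorem shift_apply (k : ℤ) (a : PString) (j : ℤ) : shift k a j = a (j - k) := by
  simp [shift, Finsupp.equivMapDomain_apply, sub_eq_add_neg]

theorem shift_shift (k l : ℤ) (a : PString) : shift k (shift l a) = shift (k + l) a := by
  ext1 j
  simp only [shift_apply]
  congr 1
  ring

theorem shift_zero (a : PString) : shift 0 a = a := by
  ext1 j
  simp [shift_apply]

theorem shift_add (k : ℤ) (a b : PString) : shift k (a + b) = shift k a + shift k b := by
  ext1 j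
  simp [shift_apply]

theorem mem_support_shift {k : ℤ} {a : PString} {j : ℤ} :
    j ∈ (shift k a).support ↔ j - k ∈ a.support := by
  simp [shift_apply]

theorem letter_add_self (a : Letter) : a + a = 0 := by
  revert a
  decide

theorem string_add_self (a : PString) : a + a = 0 := by
  ext1 j
  simpa using letter_add_self (a j)

theorem letterPhase_zero_left (a : Letter) : letterPhase 0 a = 1 := by
  rcases letter_cases a with rfl | rfl | rfl | rfl <;>
    simp [letterPhase, ← Prod.mk_zero_zero, pauli_I, pauli_X, pauli_Y, pauli_Z, Matrix.trace,
      Fin.sum_univ_two]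

theorem letterPhase_zero_right (a : Letter) : letterPhase a 0 = 1 := by
  rcases letter_cases a with rfl | rfl | rfl | rfl <;>
    simp [letterPhase, ← Prod.mk_zero_zero, pauli_I, pauli_X, pauli_Y, pauli_Z, Matrix.trace,
      Fin.sum_univ_two]

theorem phase_eq_prod {a b : PString} {W : Finset ℤ} (ha : a.support ⊆ W) (hb : b.support ⊆ W) :
    phase a b = ∏ j ∈ W, letterPhase (a j) (b j) := by
  refine Finset.prod_subset (Finset.union_subset ha hb) fun j _ hj => ?_
  simp only [Finset.mem_union, Finsupp.mem_support_iff, not_or, not_not] at hj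
  rw [hj.1, letterPhase_zero_left]

theorem phase_eq_one_of_disjoint {a b : PString} (h : ∀ j, a j = 0 ∨ b j = 0) :
    phase a b = 1 := by
  refine Finset.prod_eq_one fun j _ => ?_
  rcases h j with h | h
  · rw [h, letterPhase_zero_left]
  · rw [h, letterPhase_zero_right]

theorem phase_shift (k : ℤ) (a b : PString) : phase (shift k a) (shift k b) = phase a b := by
  refine Finset.prod_bij' (fun j _ => j - k) (fun j _ => j + k) ?_ ?_ ?_ ?_ ?_
  · intro j hj
    simpa only [Finset.mem_union, mem_support_shift] using hj
  · intro j hj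
    simpa only [Finset.mem_union, mem_support_shift, add_sub_cancel_right] using hj
  · simp
  · simp
  · intro j _
    simp only [shift_apply]

theorem gaugeFix_of_leftmost {a : PString} {m : ℤ} (h0 : a m ≠ 0) (hl : ∀ j < m, a j = 0)
    (hg : shift (-m) a 0 ≠ 0 ∧ ∀ j < 0, shift (-m) a j = 0) :
    gaugeFix a = Finsupp.single ⟨shift (-m) a, hg⟩ 1 := by
  have hne : a.support.Nonempty := ⟨m, Finsupp.mem_support_iff.2 h0⟩
  have hm : a.support.min' hne = m := by
    refine le_antisymm (Finset.min'_le _ _ (Finsupp.mem_support_iff.2 h0)) ?_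
    by_contra hlt
    exact Finsupp.mem_support_iff.1 (Finset.min'_mem a.support hne) (hl _ (not_le.1 hlt))
  rw [gaugeFix, dif_pos hne]
  congr 2
  rw [hm]

theorem exists_leftmost {a : PString} (h : a ≠ 0) : ∃ m, a m ≠ 0 ∧ ∀ j < m, a j = 0 := by
  have hne := Finsupp.support_nonempty_iff.2 h
  refine ⟨a.support.min' hne, Finsupp.mem_support_iff.1 (Finset.min'_mem _ _), fun j hj => ?_⟩
  by_contra h0
  exact absurd (Finset.min'_le a.support _ (Finsupp.mem_support_iff.2 h0)) (not_le.2 hj)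

theorem leftmost_shift {a : PString} {m : ℤ} (h0 : a m ≠ 0) (hl : ∀ j < m, a j = 0) :
    shift (-m) a 0 ≠ 0 ∧ ∀ j < 0, shift (-m) a j = 0 := by
  refine ⟨by simpa [shift_apply] using h0, fun j hj => ?_⟩
  rw [shift_apply]
  exact hl _ (by omega)

theorem gaugeFix_zero : gaugeFix 0 = 0 := by
  simp [gaugeFix]

theorem gaugeFix_coe (a : GString) : gaugeFix a.1 = Finsupp.single a 1 := by
  have e : shift (-0) a.1 = a.1 := by rw [neg_zero, shift_zero]
  rw [gaugeFix_of_leftmost (m := 0) a.2.1 a.2.2 (by rw [e]; exact a.2)]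
  congr 1
  exact Subtype.ext e

theorem gaugeFix_shift (k : ℤ) (a : PString) : gaugeFix (shift k a) = gaugeFix a := by
  by_cases h : a = 0
  · subst h
    congr 1
  · obtain ⟨m, h0, hl⟩ := exists_leftmost h
    have h0' : shift k a (m + k) ≠ 0 := by simpa [shift_apply] using h0
    have hl' : ∀ j < m + k, shift k a j = 0 := fun j hj => by
      rw [shift_apply]
      exact hl _ (by omega)
    rw [gaugeFix_of_leftmost h0 hl (leftmost_shift h0 hl),
      gaugeFix_of_leftmost h0' hl' (leftmost_shift h0' hl')]
    congr 1
    apply Subtype.ext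
    change shift (-(m + k)) (shift k a) = shift (-m) a
    rw [shift_shift]
    congr 1
    ring

/-! ### Commutators of translation sums of strings -/

/-- The commutator of the translates of `σ_a` with `σ_b`, summed over any finite set that contains
all translates overlapping `σ_b`. -/
theorem bracketString_eq_sum {a b : PString} {J : Finset ℤ} (hJ : b.support - a.support ⊆ J) :
    bracketString a b = ∑ j ∈ J,
      (phase (shift j a) b - phase b (shift j a)) • gaugeFix (shift j a + b) := by
  refine Finset.sum_subset hJ fun j _ hj => ?_
  -- Strings without a common site commute: both phases are 1, so extra translates contribute
  -- nothing.
  have hd : ∀ i, shift j a i = 0 ∨ b i = 0 := by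
    intro i
    by_contra hcon
    push Not at hcon
    refine hj (Finset.mem_sub.2 ⟨i, Finsupp.mem_support_iff.2 hcon.2, i - j, ?_, by ring⟩)
    rw [Finsupp.mem_support_iff, ← shift_apply]
    exact hcon.1
  rw [phase_eq_one_of_disjoint hd, phase_eq_one_of_disjoint fun i => (hd i).symm, sub_self,
    zero_smul]

theorem bracketString_shift (k l : ℤ) (a b : PString) :
    bracketString (shift k a) (shift l b) = bracketString a b := by
  refine Finset.sum_bij' (fun j _ => j + k - l) (fun j _ => j - k + l) ?_ ?_ ?_ ?_ ?_
  · intro j hj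
    obtain ⟨x, hx, y, hy, rfl⟩ := Finset.mem_sub.1 hj
    exact Finset.mem_sub.2 ⟨x - l, mem_support_shift.1 hx, y - k, mem_support_shift.1 hy, by ring⟩
  · intro j hj
    obtain ⟨x, hx, y, hy, rfl⟩ := Finset.mem_sub.1 hj
    exact Finset.mem_sub.2 ⟨x + l, mem_support_shift.2 (by simpa using hx), y + k,
      mem_support_shift.2 (by simpa using hy), by ring⟩
  · intro j _
    ring
  · intro j _
    ring
  · intro j _
    have e : shift j (shift k a) = shift l (shift (j + k - l) a) := by
      rw [shift_shift, shift_shift]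
      congr 1
      ring
    rw [e, phase_shift, phase_shift, ← shift_add, gaugeFix_shift]

theorem ad_single_single (a b : GString) (c d : ℂ) :
    ad (Finsupp.single a c) (Finsupp.single b d) = (c * d) • bracketString a.1 b.1 := by
  simp [ad, Finsupp.linearCombination_single, smul_smul, mul_comm]

/-- Both sides depend only on the translation classes of the strings, so commutators can be computed
from representatives standing anywhere on the chain. -/
theorem ad_gaugeFix (a b : PString) : ad (gaugeFix a) (gaugeFix b) = bracketString a b := by
  by_cases ha : a = 0
  · subst ha
    simp [gaugeFix_zero, ad, bracketString, Finsupp.linearCombination_apply]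
  by_cases hb : b = 0
  · subst hb
    simp [gaugeFix_zero, bracketString]
  obtain ⟨m, h0, hl⟩ := exists_leftmost ha
  obtain ⟨m', h0', hl'⟩ := exists_leftmost hb
  rw [gaugeFix_of_leftmost h0 hl (leftmost_shift h0 hl),
    gaugeFix_of_leftmost h0' hl' (leftmost_shift h0' hl'), ad_single_single, one_mul, one_smul]
  exact bracketString_shift _ _ _ _

/-- The bilinear commutator. -/
def adLinear : TIOp →ₗ[ℂ] Module.End ℂ TIOp where
  toFun := ad
  map_add' Q Q' := by
    ext b : 2
    simp only [ad, LinearMap.comp_apply, Finsupp.lsingle_apply, Finsupp.linearCombination_single,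
      LinearMap.add_apply, one_smul]
    exact Finsupp.sum_add_index' (by simp) (by simp [add_smul])
  map_smul' c Q := by
    ext b : 2
    simp only [ad, LinearMap.comp_apply, Finsupp.lsingle_apply, Finsupp.linearCombination_single,
      LinearMap.smul_apply, one_smul, RingHom.id_apply]
    rw [Finsupp.sum_smul_index (by simp), Finsupp.smul_sum]
    simp only [mul_smul]

theorem adLinear_apply (Q : TIOp) : adLinear Q = ad Q := rfl

/-! ### Single-site operators and their Pauli components -/

/-- Operators on a single site. -/
abbrev Site : Type := Matrix (Fin 2) (Fin 2) ℂ

/-- The coefficient of a single-site operator at the Pauli matrix `σ_α`. -/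
def component (A : Site) (α : Letter) : ℂ := (pauli α * A).trace / 2

theorem component_add (A B : Site) (α : Letter) :
    component (A + B) α = component A α + component B α := by
  simp [component, Matrix.mul_add, add_div]

theorem component_smul (c : ℂ) (A : Site) (α : Letter) :
    component (c • A) α = c * component A α := by
  simp [component, mul_div_assoc]

theorem sum_letter {X : Type*} [AddCommMonoid X] (f : Letter → X) :
    ∑ α, f α = f (0, 0) + f (1, 0) + f (1, 1) + f (0, 1) := by
  have h : (Finset.univ : Finset Letter) = {(0, 0), (1, 0), (1, 1), (0, 1)} := by decide
  rw [h, Finset.sum_insert (by decide), Finset.sum_insert (by decide),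
    Finset.sum_insert (by decide), Finset.sum_singleton]
  simp only [add_assoc]

theorem component_I (A : Site) : component A (0, 0) = (A 0 0 + A 1 1) / 2 := by
  simp only [component, pauli_I, Matrix.trace, Matrix.diag, Fin.sum_univ_two, Matrix.mul_apply]
  simp

theorem component_X (A : Site) : component A (1, 0) = (A 1 0 + A 0 1) / 2 := by
  simp only [component, pauli_X, Matrix.trace, Matrix.diag, Fin.sum_univ_two, Matrix.mul_apply]
  simp

theorem component_Y (A : Site) :
    component A (1, 1) = (-Complex.I * A 1 0 + Complex.I * A 0 1) / 2 := by
  simp only [component, pauli_Y, Matrix.trace, Matrix.diag, Fin.sum_univ_two, Matrix.mul_apply]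
  simp

theorem component_Z (A : Site) : component A (0, 1) = (A 0 0 - A 1 1) / 2 := by
  simp only [component, pauli_Z, Matrix.trace, Matrix.diag, Fin.sum_univ_two, Matrix.mul_apply]
  simp [sub_eq_add_neg]

theorem component_one (α : Letter) : component 1 α = if α = 0 then 1 else 0 := by
  rcases letter_cases α with rfl | rfl | rfl | rfl
  · rw [component_I]
    simp
  · rw [component_X]
    simp
  · rw [component_Y]
    simp
  · rw [component_Z]
    simp

/-- A single-site operator is the combination of Pauli matrices with its components. -/
theorem sum_component (A : Site) : ∑ α, component A α • pauli α = A := by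
  rw [sum_letter, component_I, component_X, component_Y, component_Z, pauli_I, pauli_X, pauli_Y,
    pauli_Z]
  ext i j
  fin_cases i <;> fin_cases j <;> simp <;> ring_nf <;> simp [Complex.I_sq] <;> ring

theorem component_pauli (α β : Letter) : component (pauli α) β = if β = α then 1 else 0 := by
  have h : (pauli β).conjTranspose = pauli β := by
    rcases letter_cases β with rfl | rfl | rfl | rfl <;>
      simp only [pauli_I, pauli_X, pauli_Y, pauli_Z] <;>
      ext i j <;> fin_cases i <;> fin_cases j <;> simp
  rw [component, ← h, trace_pauli]
  split_ifs <;> simp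

theorem component_sum {ι : Type*} (s : Finset ι) (f : ι → Site) (α : Letter) :
    component (∑ i ∈ s, f i) α = ∑ i ∈ s, component (f i) α := by
  simp [component, Finset.mul_sum, Matrix.trace_sum, Finset.sum_div]

theorem letter_eq_add_iff (α β γ : Letter) : γ = α + β ↔ β = α + γ := by
  constructor <;> rintro rfl <;> rw [← add_assoc, letter_add_self, zero_add]

/-- Letters form a group of exponent two, so `σ_α σ_β` is proportional to `σ_γ` exactly when `β = α
+ γ`. -/
theorem component_mul (A B : Site) (γ : Letter) :
    component (A * B) γ =
      ∑ α, component A α * component B (α + γ) * letterPhase α (α + γ) := by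
  conv_lhs => rw [← sum_component A, ← sum_component B]
  simp only [Finset.sum_mul, Finset.mul_sum, component_sum]
  rw [Finset.sum_comm]
  refine Finset.sum_congr rfl fun α _ => ?_
  simp only [Matrix.smul_mul, Matrix.mul_smul, component_smul, pauli_mul, component_pauli,
    letter_eq_add_iff, mul_ite, mul_one, mul_zero]
  simp
  ring

/-! ### Product operators expanded in Pauli strings -/

/-- The Pauli strings supported in a finite set of sites. -/
def window (W : Finset ℤ) : Finset PString := W.finsupp fun _ => Finset.univ

theorem mem_window {W : Finset ℤ} {a : PString} : a ∈ window W ↔ a.support ⊆ W := by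
  simp [window, Finset.mem_finsupp_iff]

theorem add_mem_window {W : Finset ℤ} {a b : PString} (ha : a ∈ window W) (hb : b ∈ window W) :
    a + b ∈ window W := by
  classical
  rw [mem_window] at *
  exact Finsupp.support_add.trans (Finset.union_subset ha hb)

theorem sum_window_add {X : Type*} [AddCommMonoid X] {W : Finset ℤ} {a : PString}
    (ha : a ∈ window W) (F : PString → X) :
    ∑ b ∈ window W, F b = ∑ b ∈ window W, F (a + b) := by
  have hinv : ∀ b : PString, a + (a + b) = b := fun b => by
    rw [← add_assoc, string_add_self, zero_add]
  refine Finset.sum_nbij' (fun b => a + b) (fun b => a + b) (fun b hb => add_mem_window ha hb)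
    (fun b hb => add_mem_window ha hb) (fun b _ => hinv b) (fun b _ => hinv b) fun b _ => ?_
  rw [hinv]

theorem sum_window_prod (W : Finset ℤ) (f : ℤ → Letter → ℂ) :
    ∑ a ∈ window W, ∏ j ∈ W, f j (a j) = ∏ j ∈ W, ∑ α, f j α := by
  classical
  rw [Finset.prod_sum, window, Finset.finsupp, Finset.sum_map]
  refine Finset.sum_congr (by congr!) fun p _ => ?_
  rw [← Finset.prod_attach]
  refine Finset.prod_congr rfl fun j _ => ?_
  simp

/-- The coefficient of a product operator at a Pauli string. -/
def coef (W : Finset ℤ) (u : ℤ → Site) (a : PString) : ℂ := ∏ j ∈ W, component (u j) (a j)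

section Expand

variable {X : Type*} [AddCommGroup X] [Module ℂ X]

/-- The linear extension of a function of Pauli strings, at the product operator with the factors
`u j` on the sites `j ∈ W`. -/
def expand (W : Finset ℤ) (u : ℤ → Site) (G : PString → X) : X :=
  ∑ a ∈ window W, coef W u a • G a

/-- The identity has component 1 at the letter 0 and none elsewhere, so sites carrying it may be
added to the window freely. -/
theorem expand_mono {W W' : Finset ℤ} (h : W ⊆ W') {u : ℤ → Site} (hu : ∀ j ∉ W, u j = 1)
    (G : PString → X) : expand W' u G = expand W u G := by
  symm
  have hsub : window W ⊆ window W' := fun a ha => mem_window.2 ((mem_window.1 ha).trans h)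
  rw [expand, expand]
  have h0 : ∀ a ∈ window W', a ∉ window W → coef W' u a • G a = 0 := by
    intro a ha ha'
    rw [mem_window, Finset.not_subset] at ha'
    obtain ⟨j, hj, hjW⟩ := ha'
    rw [coef, Finset.prod_eq_zero (mem_window.1 ha hj), zero_smul]
    rw [hu j hjW, component_one, if_neg (Finsupp.mem_support_iff.1 hj)]
  rw [← Finset.sum_subset hsub h0]
  refine Finset.sum_congr rfl fun a ha => ?_
  congr 1
  refine Finset.prod_subset h fun j _ hj => ?_
  rw [hu j hj, component_one, if_pos]
  by_contra hne
  exact hj (mem_window.1 ha (Finsupp.mem_support_iff.2 hne))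

theorem expand_shift (W : Finset ℤ) (u : ℤ → Site) (k : ℤ) (G : PString → X) :
    expand W u (fun a => G (shift k a)) =
      expand (W.map (Equiv.addRight k).toEmbedding) (fun j => u (j - k)) G := by
  refine Finset.sum_bij' (fun a _ => shift k a) (fun a _ => shift (-k) a) ?_ ?_ ?_ ?_ ?_
  · intro a ha
    rw [mem_window] at ha ⊢
    intro j hj
    exact Finset.mem_map.2 ⟨j - k, ha (mem_support_shift.1 hj), by simp⟩
  · intro a ha
    rw [mem_window] at ha ⊢
    intro j hj
    obtain ⟨i, hi, e⟩ := Finset.mem_map.1 (ha (mem_support_shift.1 hj))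
    simp only [Equiv.coe_toEmbedding, Equiv.coe_addRight, sub_neg_eq_add, add_left_inj] at e
    exact e ▸ hi
  · intro a _
    rw [shift_shift, neg_add_cancel, shift_zero]
  · intro a _
    rw [shift_shift, add_neg_cancel, shift_zero]
  · intro a _
    congr 1
    rw [coef, coef, Finset.prod_map]
    simp [shift_apply]

theorem expand_shift_mono {W W' : Finset ℤ} {u : ℤ → Site} {k : ℤ} (h : ∀ j ∈ W, j + k ∈ W')
    (hu : ∀ j ∉ W, u j = 1) (G : PString → X) :
    expand W u (fun a => G (shift k a)) = expand W' (fun j => u (j - k)) G := by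
  rw [expand_shift]
  symm
  apply expand_mono
  · intro j hj
    obtain ⟨i, hi, rfl⟩ := Finset.mem_map.1 hj
    exact h i hi
  · intro j hj
    refine hu _ fun hmem => hj (Finset.mem_map.2 ⟨_, hmem, by simp⟩)

theorem expand_congr {W : Finset ℤ} {u v : ℤ → Site} (h : ∀ j ∈ W, u j = v j)
    (G : PString → X) : expand W u G = expand W v G := by
  refine Finset.sum_congr rfl fun a _ => ?_
  congr 1
  exact Finset.prod_congr rfl fun j hj => by rw [h j hj]

theorem expand_congr_right {W : Finset ℤ} {u : ℤ → Site} {G G' : PString → X}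
    (h : ∀ a ∈ window W, G a = G' a) : expand W u G = expand W u G' := by
  rw [expand, expand]
  exact Finset.sum_congr rfl fun a ha => by rw [h a ha]

theorem coef_update {W : Finset ℤ} {i : ℤ} (hi : i ∈ W) (u : ℤ → Site) (C : Site) (a : PString) :
    coef W (Function.update u i C) a =
      component C (a i) * ∏ j ∈ W \ {i}, component (u j) (a j) := by
  rw [coef, Finset.prod_eq_mul_prod_sdiff_singleton_of_mem hi, Function.update_self]
  congr 1
  refine Finset.prod_congr rfl fun j hj => ?_
  rw [Function.update_of_ne]
  simpa using (Finset.mem_sdiff.1 hj).2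

theorem expand_update_add {W : Finset ℤ} {i : ℤ} (hi : i ∈ W) (u : ℤ → Site) (A B : Site)
    (G : PString → X) :
    expand W (Function.update u i (A + B)) G =
      expand W (Function.update u i A) G + expand W (Function.update u i B) G := by
  simp only [expand, ← Finset.sum_add_distrib, ← add_smul]
  refine Finset.sum_congr rfl fun a _ => ?_
  congr 1
  rw [coef_update hi, coef_update hi, coef_update hi, component_add, add_mul]

theorem expand_update_smul {W : Finset ℤ} {i : ℤ} (hi : i ∈ W) (u : ℤ → Site) (c : ℂ) (A : Site)
    (G : PString → X) :
    expand W (Function.update u i (c • A)) G = c • expand W (Function.update u i A) G := by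
  simp only [expand, Finset.smul_sum, smul_smul]
  refine Finset.sum_congr rfl fun a _ => ?_
  congr 1
  rw [coef_update hi, coef_update hi, component_smul, mul_assoc]

/-- Product operators are multiplied site by site. -/
theorem expand_mul (W : Finset ℤ) (u v : ℤ → Site) (G : PString → X) :
    expand W u (fun a => expand W v fun b => phase a b • G (a + b)) =
      expand W (fun j => u j * v j) G := by
  have h : ∀ a ∈ window W, coef W u a • expand W v (fun b => phase a b • G (a + b)) =
      ∑ g ∈ window W, (∏ j ∈ W, component (u j) (a j) * component (v j) (a j + g j) *
        letterPhase (a j) (a j + g j)) • G g := by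
    intro a ha
    rw [expand, Finset.smul_sum]
    -- Adding `a` is an involution of the window, so the sum over `b` becomes a sum over the product
    -- string `g = a + b`, with `b = a + g`. The sum over `a` then factorizes over sites.
    rw [sum_window_add ha]
    refine Finset.sum_congr rfl fun g hg => ?_
    rw [smul_smul, smul_smul, phase_eq_prod (mem_window.1 ha)
      (mem_window.1 (add_mem_window ha hg)), coef, coef, ← Finset.prod_mul_distrib,
      ← Finset.prod_mul_distrib, ← add_assoc, string_add_self, zero_add]
    rfl
  rw [expand, Finset.sum_congr rfl h, Finset.sum_comm]
  refine Finset.sum_congr rfl fun g _ => ?_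
  rw [← Finset.sum_smul, sum_window_prod W fun j α =>
    component (u j) α * component (v j) (α + g j) * letterPhase α (α + g j)]
  simp only [← component_mul]
  rfl

/-- The translationally invariant operator generated by a product operator. -/
def tiOp (W : Finset ℤ) (u : ℤ → Site) : TIOp := expand W u gaugeFix

theorem expand_sum {ι : Type*} (W : Finset ℤ) (u : ℤ → Site) (s : Finset ι)
    (G : ι → PString → X) :
    expand W u (fun a => ∑ i ∈ s, G i a) = ∑ i ∈ s, expand W u (G i) := by
  simp only [expand, Finset.smul_sum]
  exact Finset.sum_comm

theorem expand_sub (W : Finset ℤ) (u : ℤ → Site) (G G' : PString → X) :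
    expand W u (fun a => G a - G' a) = expand W u G - expand W u G' := by
  simp only [expand, smul_sub, Finset.sum_sub_distrib]

theorem expand_comm (W W' : Finset ℤ) (u v : ℤ → Site) (G : PString → PString → X) :
    expand W u (fun a => expand W' v (G a)) = expand W' v (fun b => expand W u fun a => G a b) := by
  simp only [expand, Finset.smul_sum]
  rw [Finset.sum_comm]
  simp only [smul_smul, mul_comm]

theorem ad_tiOp_eq_expand (W₁ W₂ : Finset ℤ) (u v : ℤ → Site) :
    ad (tiOp W₁ u) (tiOp W₂ v) =
      expand W₁ u fun a => expand W₂ v fun b => bracketString a b := by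
  rw [← adLinear_apply]
  simp only [tiOp, expand, map_sum, map_smul, LinearMap.sum_apply, LinearMap.smul_apply,
    adLinear_apply, ad_gaugeFix]
  simp only [Finset.smul_sum]
  rw [Finset.sum_comm]
  simp only [smul_comm (coef W₂ v _)]

theorem expand_phase_shift {W₁ W₂ W : Finset ℤ} {u v : ℤ → Site} {k : ℤ} (hu : ∀ j ∉ W₁, u j = 1)
    (hv : ∀ j ∉ W₂, v j = 1) (h₂ : W₂ ⊆ W) (h₁ : ∀ j ∈ W₁, j + k ∈ W) (G : PString → X) :
    expand W₁ u (fun a => expand W₂ v fun b => phase (shift k a) b • G (shift k a + b)) =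
      expand W (fun j => u (j - k) * v j) G := by
  rw [expand_shift_mono h₁ hu fun a => expand W₂ v fun b => phase a b • G (a + b),
    ← expand_mul]
  refine expand_congr_right fun a _ => ?_
  rw [expand_mono h₂ hv]

theorem expand_phase_shift_right {W₁ W₂ W : Finset ℤ} {u v : ℤ → Site} {k : ℤ}
    (hu : ∀ j ∉ W₁, u j = 1)
    (hv : ∀ j ∉ W₂, v j = 1) (h₂ : W₂ ⊆ W) (h₁ : ∀ j ∈ W₁, j + k ∈ W) (G : PString → X) :
    expand W₁ u (fun a => expand W₂ v fun b => phase b (shift k a) • G (b + shift k a)) =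
      expand W (fun j => v j * u (j - k)) G := by
  rw [expand_shift_mono h₁ hu fun a => expand W₂ v fun b => phase b a • G (b + a),
    ← expand_mul, expand_comm, expand_mono h₂ hv]

/-- The commutator of translationally invariant operators generated by product operators. -/
theorem ad_tiOp {W₁ W₂ W J : Finset ℤ} {u v : ℤ → Site} (hu : ∀ j ∉ W₁, u j = 1)
    (hv : ∀ j ∉ W₂, v j = 1) (hJ : W₂ - W₁ ⊆ J) (h₂ : W₂ ⊆ W)
    (h₁ : ∀ k ∈ J, ∀ j ∈ W₁, j + k ∈ W) :
    ad (tiOp W₁ u) (tiOp W₂ v) = ∑ k ∈ J,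
      (tiOp W (fun j => u (j - k) * v j) - tiOp W (fun j => v j * u (j - k))) := by
  have e : ∀ a ∈ window W₁, ∀ b ∈ window W₂, bracketString a b = ∑ k ∈ J,
      (phase (shift k a) b • gaugeFix (shift k a + b) -
        phase b (shift k a) • gaugeFix (b + shift k a)) := by
    intro a ha b hb
    rw [bracketString_eq_sum ((Finset.sub_subset_sub (mem_window.1 hb) (mem_window.1 ha)).trans hJ)]
    simp only [sub_smul, add_comm b]
  rw [ad_tiOp_eq_expand,
    expand_congr_right fun a ha => expand_congr_right fun b hb => e a ha b hb]
  simp only [expand_sum, expand_sub]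
  refine Finset.sum_congr rfl fun k hk => ?_
  rw [expand_phase_shift hu hv h₂ (h₁ k hk), expand_phase_shift_right hu hv h₂ (h₁ k hk)]
  rfl

end Expand

/-! ### Frobenius norm of translation sums of product operators -/

theorem toHilbert_single (a : GString) (c : ℂ) :
    toHilbert (Finsupp.single a c) = by classical exact lp.single 2 a c := by
  classical
  simp only [toHilbert, Finsupp.linearCombination_single]
  rw [← lp.single_smul]
  simp

theorem frobNorm_sq (Q : TIOp) : frobNorm Q ^ 2 = ∑ a ∈ Q.support, ‖Q a‖ ^ 2 := by
  classical
  have h : toHilbert Q = ∑ a ∈ Q.support, lp.single 2 a (Q a) := by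
    conv_lhs => rw [← Finsupp.sum_single Q]
    rw [Finsupp.sum, map_sum]
    exact Finset.sum_congr rfl fun a _ => by rw [toHilbert_single]
  have := lp.norm_sum_single (E := fun _ : GString => ℂ) (p := 2) (by norm_num) (fun a => Q a)
    Q.support
  rw [frobNorm, h]
  simpa using this

theorem frobNorm_nonneg (Q : TIOp) : 0 ≤ frobNorm Q := norm_nonneg _

theorem frobNorm_add_le (Q Q' : TIOp) : frobNorm (Q + Q') ≤ frobNorm Q + frobNorm Q' := by
  rw [frobNorm, map_add]
  exact norm_add_le _ _

theorem frobNorm_smul (c : ℂ) (Q : TIOp) : frobNorm (c • Q) = ‖c‖ * frobNorm Q := by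
  rw [frobNorm, map_smul, norm_smul, frobNorm]

theorem frobNorm_zero : frobNorm 0 = 0 := by simp [frobNorm]

theorem eq_zero_of_frobNorm_eq_zero {Q : TIOp} (h : frobNorm Q = 0) : Q = 0 := by
  have h2 := frobNorm_sq Q
  rw [h, zero_pow two_ne_zero, eq_comm, Finset.sum_eq_zero_iff_of_nonneg (fun _ _ => sq_nonneg _)]
    at h2
  ext a
  by_contra hne
  have := h2 a (Finsupp.mem_support_iff.2 hne)
  exact hne (by simpa using this)

/-- Product operators with a traceless factor of norm at most one on every site of a nonempty set
have intensive Frobenius norm at most one. -/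
theorem frobNorm_tiOp_le_of_traceless {S : Finset ℤ} {u : ℤ → Site} (hS : S.Nonempty)
    (h0 : ∀ j ∈ S, component (u j) 0 = 0) (h1 : ∀ j ∈ S, ∑ α, ‖component (u j) α‖ ^ 2 ≤ 1) :
    frobNorm (tiOp S u) ≤ 1 := by
  classical
  obtain ⟨m, hmS, hmin⟩ : ∃ m ∈ S, ∀ j ∈ S, m ≤ j :=
    ⟨S.min' hS, S.min'_mem hS, fun j hj => S.min'_le j hj⟩
  -- Tracelessness on all of `S` forces every contributing string to start at the same site `m`.
  -- Gauge fixing is then one common shift, no two strings merge, and the norm squared is bounded by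
  -- the product of the one-site norms squared.
  have hval : ∀ a : GString, tiOp S u a =
      if shift m a.1 ∈ window S then coef S u (shift m a.1) else 0 := by
    intro a
    have hterm : ∀ b ∈ window S, (coef S u b • gaugeFix b) a =
        if b = shift m a.1 then coef S u b else 0 := by
      intro b hb
      by_cases hc : coef S u b = 0
      · simp [hc]
      have hbm : b m ≠ 0 := by
        intro hbm
        exact hc (Finset.prod_eq_zero hmS (by rw [hbm, h0 m hmS]))
      have hbl : ∀ j < m, b j = 0 := by
        intro j hj
        by_contra hne
        exact absurd (hmin j (mem_window.1 hb (Finsupp.mem_support_iff.2 hne))) (not_le.2 hj)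
      rw [gaugeFix_of_leftmost hbm hbl (leftmost_shift hbm hbl), Finsupp.smul_apply,
        Finsupp.single_apply]
      have hiff : (⟨shift (-m) b, leftmost_shift hbm hbl⟩ : GString) = a ↔ b = shift m a.1 := by
        rw [Subtype.ext_iff]
        constructor
        · intro h
          rw [← h, shift_shift, add_neg_cancel, shift_zero]
        · rintro h
          change shift (-m) b = a.1
          rw [h, shift_shift, neg_add_cancel, shift_zero]
      simp only [hiff, smul_eq_mul, mul_ite, mul_one, mul_zero]
    rw [tiOp, expand, Finsupp.finsetSum_apply, Finset.sum_congr rfl hterm, Finset.sum_ite_eq']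
  have hsq : frobNorm (tiOp S u) ^ 2 ≤ 1 := by
    rw [frobNorm_sq]
    have hmem : ∀ a ∈ (tiOp S u).support, shift m a.1 ∈ window S := by
      intro a ha
      by_contra hn
      rw [Finsupp.mem_support_iff, hval, if_neg hn] at ha
      exact ha rfl
    have hinj : Set.InjOn (fun a : GString => shift m a.1) (tiOp S u).support := by
      intro a _ b _ hab
      apply Subtype.ext
      have := congrArg (shift (-m)) hab
      simpa only [shift_shift, neg_add_cancel, shift_zero] using this
    calc ∑ a ∈ (tiOp S u).support, ‖tiOp S u a‖ ^ 2
        = ∑ a ∈ (tiOp S u).support, ‖coef S u (shift m a.1)‖ ^ 2 :=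
          Finset.sum_congr rfl fun a ha => by rw [hval, if_pos (hmem a ha)]
      _ = ∑ b ∈ (tiOp S u).support.image (fun a : GString => shift m a.1), ‖coef S u b‖ ^ 2 :=
          (Finset.sum_image (f := fun b => ‖coef S u b‖ ^ 2) hinj).symm
      _ ≤ ∑ b ∈ window S, ‖coef S u b‖ ^ 2 :=
          Finset.sum_le_sum_of_subset_of_nonneg
            (Finset.image_subset_iff.2 hmem) fun _ _ _ => sq_nonneg _
      _ = ∏ j ∈ S, ∑ α, ‖component (u j) α‖ ^ 2 := by
          have := sum_window_prod S fun j α => ((‖component (u j) α‖ ^ 2 : ℝ) : ℂ)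
          have h2 : ((∑ b ∈ window S, ‖coef S u b‖ ^ 2 : ℝ) : ℂ) =
              ((∏ j ∈ S, ∑ α, ‖component (u j) α‖ ^ 2 : ℝ) : ℂ) := by
            push_cast
            push_cast at this
            rw [← this]
            refine Finset.sum_congr rfl fun b _ => ?_
            rw [coef, norm_prod]
            push_cast
            rw [Finset.prod_pow]
          exact_mod_cast h2
      _ ≤ 1 := Finset.prod_le_one
          (fun j _ => Finset.sum_nonneg fun _ _ => sq_nonneg _) h1
  have := frobNorm_nonneg (tiOp S u)
  nlinarith

theorem tiOp_empty (u : ℤ → Site) : tiOp ∅ u = 0 := by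
  have : window ∅ = {0} := by
    ext a
    simp [mem_window]
  simp [tiOp, expand, this, gaugeFix_zero]

/-- The identity, or a traceless matrix of normalized Hilbert–Schmidt norm at most one. -/
def IsPure (A : Site) : Prop := A = 1 ∨ (component A 0 = 0 ∧ ∑ α, ‖component A α‖ ^ 2 ≤ 1)

/-- Sites carrying the identity can be removed from the window. The remaining factors are all
traceless, or the window is empty and the operator vanishes. -/
theorem frobNorm_tiOp_le_of_isPure {W : Finset ℤ} {u : ℤ → Site} (h : ∀ j ∈ W, IsPure (u j)) :
    frobNorm (tiOp W u) ≤ 1 := by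
  classical
  set S := W.filter fun j => u j ≠ 1 with hS
  have e1 : tiOp W u = tiOp W fun j => if j ∈ W then u j else 1 :=
    expand_congr (fun j hj => by rw [if_pos hj]) _
  have e2 : (tiOp W fun j => if j ∈ W then u j else 1) =
      tiOp S fun j => if j ∈ W then u j else 1 := by
    refine expand_mono (Finset.filter_subset _ _) (fun j hj => ?_) _
    split_ifs with hW
    · by_contra hne
      exact hj (Finset.mem_filter.2 ⟨hW, hne⟩)
    · rfl
  have e3 : (tiOp S fun j => if j ∈ W then u j else 1) = tiOp S u :=
    expand_congr (fun j hj => by rw [if_pos (Finset.mem_filter.1 hj).1]) _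
  rw [e1, e2, e3]
  rcases S.eq_empty_or_nonempty with he | hne
  · rw [he, tiOp_empty, frobNorm_zero]
    exact zero_le_one
  · have hp : ∀ j ∈ S, component (u j) 0 = 0 ∧ ∑ α, ‖component (u j) α‖ ^ 2 ≤ 1 := fun j hj =>
      (h j (Finset.mem_filter.1 hj).1).resolve_left (Finset.mem_filter.1 hj).2
    exact frobNorm_tiOp_le_of_traceless hne (fun j hj => (hp j hj).1) fun j hj => (hp j hj).2

/-- An absolutely convex combination of the identity and a traceless contraction. -/
def IsMixed (A : Site) : Prop :=
  ∃ (α β : ℂ) (N : Site), ‖α‖ + ‖β‖ ≤ 1 ∧ IsPure N ∧ A = α • 1 + β • N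

/-- Splitting a mixed factor writes the operator as an absolutely convex combination of two
operators with a pure factor at that site, so no norm is lost. The induction makes the sites of `F`
pure one at a time. -/
theorem frobNorm_tiOp_le_one {W : Finset ℤ} {u : ℤ → Site} (h : ∀ j ∈ W, IsMixed (u j)) :
    frobNorm (tiOp W u) ≤ 1 := by
  suffices H : ∀ F : Finset ℤ, F ⊆ W → ∀ u : ℤ → Site, (∀ j ∈ F, IsMixed (u j)) →
      (∀ j ∈ W \ F, IsPure (u j)) → frobNorm (tiOp W u) ≤ 1 from
    H W subset_rfl u h (by simp)
  intro F
  induction F using Finset.induction_on with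
  | empty => exact fun _ u _ hp => frobNorm_tiOp_le_of_isPure (by simpa using hp)
  | insert i F hi ih =>
    intro hF u hm hp
    obtain ⟨α, β, N, hαβ, hN, hA⟩ := hm i (Finset.mem_insert_self _ _)
    have hiW : i ∈ W := hF (Finset.mem_insert_self _ _)
    have key : ∀ C, IsPure C → frobNorm (tiOp W (Function.update u i C)) ≤ 1 := by
      intro C hC
      refine ih ((Finset.subset_insert _ _).trans hF) _ ?_ ?_
      · intro j hj
        rw [Function.update_of_ne (by rintro rfl; exact hi hj)]
        exact hm j (Finset.mem_insert_of_mem hj)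
      · intro j hj
        rcases eq_or_ne j i with rfl | hne
        · rwa [Function.update_self]
        · rw [Function.update_of_ne hne]
          refine hp j ?_
          simp only [Finset.mem_sdiff, Finset.mem_insert, not_or] at hj ⊢
          exact ⟨hj.1, hne, hj.2⟩
    have e : tiOp W u =
        α • tiOp W (Function.update u i 1) + β • tiOp W (Function.update u i N) := by
      conv_lhs => rw [← Function.update_eq_self i u, hA]
      rw [tiOp, expand_update_add hiW, expand_update_smul hiW, expand_update_smul hiW]
      rfl
    have h1 := key 1 (Or.inl rfl)
    have h2 := key N hN
    calc frobNorm (tiOp W u) ≤ ‖α‖ * frobNorm (tiOp W (Function.update u i 1)) +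
          ‖β‖ * frobNorm (tiOp W (Function.update u i N)) := by
          rw [e, ← frobNorm_smul, ← frobNorm_smul]
          exact frobNorm_add_le _ _
      _ ≤ ‖α‖ * 1 + ‖β‖ * 1 := by gcongr
      _ ≤ 1 := by simpa using hαβ

/-! ### Ranges of product operators -/

theorem gaugeFix_mem_rangeSpace {a : PString} {k : ℤ} {r : ℕ}
    (ha : a.support ⊆ Finset.Icc k (k + r)) : gaugeFix a ∈ rangeSpace (r + 1) := by
  by_cases h : a = 0
  · rw [h, gaugeFix_zero]
    exact Submodule.zero_mem _
  obtain ⟨m, h0, hl⟩ := exists_leftmost h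
  have hm := Finset.mem_Icc.1 (ha (Finsupp.mem_support_iff.2 h0))
  rw [gaugeFix_of_leftmost h0 hl (leftmost_shift h0 hl)]
  refine Finsupp.single_mem_supported ℂ _ ?_
  intro j hj
  change shift (-m) a j = 0
  rw [shift_apply]
  by_contra hne
  have := Finset.mem_Icc.1 (ha (Finsupp.mem_support_iff.2 hne))
  push_cast at hj
  omega

theorem tiOp_mem_rangeSpace (k : ℤ) (r : ℕ) (u : ℤ → Site) :
    tiOp (Finset.Icc k (k + r)) u ∈ rangeSpace (r + 1) :=
  Submodule.sum_mem _ fun _ ha =>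
    Submodule.smul_mem _ _ (gaugeFix_mem_rangeSpace (mem_window.1 ha))

/-! ### The rotated frame and the admissible site factors -/

/-- A single-site operator in a rotated frame. -/
def rot (U X : Site) : Site := U * X * U.conjTranspose

theorem rot_mul {U : Site} (hU : U.conjTranspose * U = 1) (X Y : Site) :
    rot U X * rot U Y = rot U (X * Y) := by
  simp only [rot]
  calc U * X * U.conjTranspose * (U * Y * U.conjTranspose)
      = U * X * (U.conjTranspose * U) * Y * U.conjTranspose := by simp only [Matrix.mul_assoc]
    _ = _ := by rw [hU, Matrix.mul_one]; simp only [Matrix.mul_assoc]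

theorem rot_one {U : Site} (hU : U.conjTranspose * U = 1) : rot U 1 = 1 := by
  rw [rot, Matrix.mul_one]
  exact mul_eq_one_comm.1 hU

theorem rot_add (U X Y : Site) : rot U (X + Y) = rot U X + rot U Y := by
  simp only [rot, Matrix.mul_add, Matrix.add_mul]

theorem rot_sub (U X Y : Site) : rot U (X - Y) = rot U X - rot U Y := by
  simp only [rot, Matrix.mul_sub, Matrix.sub_mul]

theorem rot_smul (U : Site) (c : ℂ) (X : Site) : rot U (c • X) = c • rot U X := by
  simp only [rot, Matrix.mul_smul, Matrix.smul_mul]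

theorem trace_conjTranspose_mul_self (A : Site) :
    (A.conjTranspose * A).trace = 2 * ∑ α, (‖component A α‖ ^ 2 : ℝ) := by
  conv_lhs => rw [← sum_component A]
  simp only [Matrix.conjTranspose_sum, Matrix.conjTranspose_smul, Finset.sum_mul, Finset.mul_sum,
    Matrix.trace_sum, Matrix.smul_mul, Matrix.mul_smul, Matrix.trace_smul, trace_pauli]
  push_cast
  simp only [smul_eq_mul, mul_ite, mul_zero, Finset.mul_sum]
  rw [Finset.sum_comm]
  refine Finset.sum_congr rfl fun α _ => ?_
  rw [← Complex.mul_conj']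
  simp only [RCLike.star_def]
  simp
  ring

theorem sum_sq_component_rot {U : Site} (hU : U.conjTranspose * U = 1) (X : Site) :
    ∑ α, ‖component (rot U X) α‖ ^ 2 = ∑ α, ‖component X α‖ ^ 2 := by
  have h : ((rot U X).conjTranspose * rot U X).trace = (X.conjTranspose * X).trace := by
    have e : (rot U X).conjTranspose = rot U X.conjTranspose := by
      simp only [rot, Matrix.conjTranspose_mul, Matrix.conjTranspose_conjTranspose,
        Matrix.mul_assoc]
    rw [e, rot_mul hU, rot, Matrix.trace_mul_comm, ← Matrix.mul_assoc, hU, Matrix.one_mul]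
  rw [trace_conjTranspose_mul_self, trace_conjTranspose_mul_self] at h
  have h2 := mul_left_cancel₀ two_ne_zero h
  exact_mod_cast h2

theorem component_rot_zero {U : Site} (hU : U.conjTranspose * U = 1) (X : Site) :
    component (rot U X) 0 = component X 0 := by
  have h : ∀ A : Site, component A 0 = A.trace / 2 := fun A => by
    rw [component, ← Prod.mk_zero_zero, pauli, if_pos rfl, Matrix.one_mul]
  rw [h, h, rot, Matrix.trace_mul_comm, ← Matrix.mul_assoc, hU, Matrix.one_mul]

/-- Multiples of the raising operator, multiples of the lowering operator and diagonal matrices, of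
size at most one, in a rotated frame. -/
def siteSet (U : Site) : Set Site :=
  {A | (∃ α β : ℂ, ‖α‖ + ‖β‖ ≤ 1 ∧ A = rot U !![α + β, 0; 0, α - β]) ∨
    (∃ c : ℂ, ‖c‖ ≤ 1 ∧ A = rot U !![0, c; 0, 0]) ∨ ∃ c : ℂ, ‖c‖ ≤ 1 ∧ A = rot U !![0, 0; c, 0]}

theorem diag_mem_siteSet (U : Site) {α β : ℂ} (h : ‖α‖ + ‖β‖ ≤ 1) {X : Site}
    (hX : X = !![α + β, 0; 0, α - β]) : rot U X ∈ siteSet U :=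
  Or.inl ⟨α, β, h, by rw [hX]⟩

theorem raising_mem_siteSet (U : Site) {c : ℂ} (h : ‖c‖ ≤ 1) {X : Site}
    (hX : X = !![0, c; 0, 0]) : rot U X ∈ siteSet U :=
  Or.inr (Or.inl ⟨c, h, by rw [hX]⟩)

theorem lowering_mem_siteSet (U : Site) {c : ℂ} (h : ‖c‖ ≤ 1) {X : Site}
    (hX : X = !![0, 0; c, 0]) : rot U X ∈ siteSet U :=
  Or.inr (Or.inr ⟨c, h, by rw [hX]⟩)

theorem one_mem_siteSet {U : Site} (hU : U.conjTranspose * U = 1) : (1 : Site) ∈ siteSet U := by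
  rw [← rot_one hU]
  refine diag_mem_siteSet U (α := 1) (β := 0) (by simp) ?_
  simp [Matrix.one_fin_two]

/-- Diagonal factors multiply as `(α + βZ)(α' + β'Z)` with `Z² = 1`, for which `‖α‖ + ‖β‖` is
submultiplicative. It also bounds both diagonal entries, so a diagonal factor times a raising or
lowering one stays admissible. The square of a raising or lowering operator vanishes. -/
theorem mul_mem_siteSet {U : Site} (hU : U.conjTranspose * U = 1) {A B : Site}
    (hA : A ∈ siteSet U) (hB : B ∈ siteSet U) : A * B ∈ siteSet U := by
  have hadd : ∀ α β c : ℂ, ‖α‖ + ‖β‖ ≤ 1 → ‖c‖ ≤ 1 → ‖(α + β) * c‖ ≤ 1 := by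
    intro α β c h hc
    rw [norm_mul]
    exact mul_le_one₀ ((norm_add_le _ _).trans h) (norm_nonneg _) hc
  have hsub : ∀ α β c : ℂ, ‖α‖ + ‖β‖ ≤ 1 → ‖c‖ ≤ 1 → ‖(α - β) * c‖ ≤ 1 := by
    intro α β c h hc
    rw [norm_mul]
    exact mul_le_one₀ ((norm_sub_le _ _).trans h) (norm_nonneg _) hc
  have hmul : ∀ c d : ℂ, ‖c‖ ≤ 1 → ‖d‖ ≤ 1 → ‖c * d‖ ≤ 1 := by
    intro c d hc hd
    rw [norm_mul]
    exact mul_le_one₀ hc (norm_nonneg _) hd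
  rcases hA with ⟨α, β, h, rfl⟩ | ⟨c, h, rfl⟩ | ⟨c, h, rfl⟩ <;>
    rcases hB with ⟨α', β', h', rfl⟩ | ⟨c', h', rfl⟩ | ⟨c', h', rfl⟩ <;> rw [rot_mul hU]
  · refine diag_mem_siteSet U (α := α * α' + β * β') (β := α * β' + β * α') ?_ ?_
    · calc ‖α * α' + β * β'‖ + ‖α * β' + β * α'‖
          ≤ (‖α‖ * ‖α'‖ + ‖β‖ * ‖β'‖) + (‖α‖ * ‖β'‖ + ‖β‖ * ‖α'‖) := by
            simp only [← norm_mul]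
            exact add_le_add (norm_add_le _ _) (norm_add_le _ _)
        _ = (‖α‖ + ‖β‖) * (‖α'‖ + ‖β'‖) := by ring
        _ ≤ 1 := mul_le_one₀ h (by positivity) h'
    · ext i j
      fin_cases i <;> fin_cases j <;> simp <;> ring
  · refine raising_mem_siteSet U (c := (α + β) * c') (hadd _ _ _ h h') ?_
    simp
  · refine lowering_mem_siteSet U (c := (α - β) * c') (hsub _ _ _ h h') ?_
    simp
  · refine raising_mem_siteSet U (c := (α' - β') * c) (hsub _ _ _ h' h) ?_
    ext i j
    fin_cases i <;> fin_cases j <;> simp [mul_comm]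
  · exact diag_mem_siteSet U (α := 0) (β := 0) (by simp)
      (by ext i j; fin_cases i <;> fin_cases j <;> simp)
  -- Raising times lowering is the projector `(1 + Z)/2` up to a scalar, and its two halves add up
  -- to size `‖c c'‖`.
  · refine diag_mem_siteSet U (α := c * c' / 2) (β := c * c' / 2) ?_
      (by ext i j; fin_cases i <;> fin_cases j <;> simp)
    have := hmul c c' h h'
    simp only [norm_div, Complex.norm_ofNat]
    linarith
  · refine lowering_mem_siteSet U (c := (α' + β') * c) (hadd _ _ _ h' h) ?_
    ext i j
    fin_cases i <;> fin_cases j <;> simp [mul_comm]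
  · refine diag_mem_siteSet U (α := c * c' / 2) (β := -(c * c' / 2)) ?_
      (by ext i j; fin_cases i <;> fin_cases j <;> simp)
    have := hmul c c' h h'
    simp only [norm_neg, norm_div, Complex.norm_ofNat]
    linarith
  · exact diag_mem_siteSet U (α := 0) (β := 0) (by simp)
      (by ext i j; fin_cases i <;> fin_cases j <;> simp)

theorem isPure_rot {U : Site} (hU : U.conjTranspose * U = 1) {X : Site} (h0 : component X 0 = 0)
    (h1 : ∑ α, ‖component X α‖ ^ 2 ≤ 1) : IsPure (rot U X) :=
  Or.inr ⟨by rw [component_rot_zero hU, h0], by rwa [sum_sq_component_rot hU]⟩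

/-- `Z` has normalized norm 1, and the raising and lowering operators have normalized norm squared
1/2. All three are traceless, and unitary rotation preserves both properties. -/
theorem isMixed_of_mem_siteSet {U : Site} (hU : U.conjTranspose * U = 1) {A : Site}
    (hA : A ∈ siteSet U) : IsMixed A := by
  rcases hA with ⟨α, β, h, rfl⟩ | ⟨c, h, rfl⟩ | ⟨c, h, rfl⟩
  · refine ⟨α, β, rot U !![1, 0; 0, -1], h, isPure_rot hU ?_ ?_, ?_⟩
    · simp [← Prod.mk_zero_zero, component_I]
    · simp [sum_letter, component_I, component_X, component_Y, component_Z]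
    · rw [← rot_one hU, ← rot_smul, ← rot_smul, ← rot_add]
      congr 1
      ext i j
      fin_cases i <;> fin_cases j <;> simp [sub_eq_add_neg]
  · refine ⟨0, c, rot U !![0, 1; 0, 0], by simpa using h, isPure_rot hU ?_ ?_, ?_⟩
    · simp [← Prod.mk_zero_zero, component_I]
    · simp [sum_letter, component_I, component_X, component_Y, component_Z]
      norm_num
    · rw [zero_smul, zero_add, ← rot_smul]
      simp
  · refine ⟨0, c, rot U !![0, 0; 1, 0], by simpa using h, isPure_rot hU ?_ ?_, ?_⟩
    · simp [← Prod.mk_zero_zero, component_I]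
    · simp [sum_letter, component_I, component_X, component_Y, component_Z]
      norm_num
    · rw [zero_smul, zero_add, ← rot_smul]
      simp

/-- The elements of `siteSet` are eigenvectors of the commutator with the field direction. -/
theorem exists_eigenvalue_of_mem_siteSet {U : Site} (hU : U.conjTranspose * U = 1) {A : Site}
    (hA : A ∈ siteSet U) :
    ∃ d : ℤ, rot U !![1, 0; 0, -1] * A - A * rot U !![1, 0; 0, -1] = (2 * d : ℂ) • A := by
  rcases hA with ⟨α, β, h, rfl⟩ | ⟨c, h, rfl⟩ | ⟨c, h, rfl⟩
  · refine ⟨0, ?_⟩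
    rw [rot_mul hU, rot_mul hU, ← rot_sub, ← rot_smul]
    congr 1
    simp
  · refine ⟨1, ?_⟩
    rw [rot_mul hU, rot_mul hU, ← rot_sub, ← rot_smul]
    congr 1
    ext i j
    fin_cases i <;> fin_cases j <;> simp
    ring
  · refine ⟨-1, ?_⟩
    rw [rot_mul hU, rot_mul hU, ← rot_sub, ← rot_smul]
    congr 1
    ext i j
    fin_cases i <;> fin_cases j <;> simp
    ring

/-- The commutator with a uniform field along the rotated axis acts diagonally. -/
theorem ad_field_tiOp {U : Site} (hU : U.conjTranspose * U = 1) {W : Finset ℤ} {u : ℤ → Site}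
    (hu : ∀ j ∈ W, u j ∈ siteSet U) (hu1 : ∀ j ∉ W, u j = 1) :
    ∃ d : ℤ, ad (tiOp {0} (Function.update (1 : ℤ → Site) 0 (rot U !![1, 0; 0, -1]))) (tiOp W u) =
      (2 * d : ℂ) • tiOp W u := by
  classical
  set Z := rot U !![1, 0; 0, -1] with hZ
  have hd : ∀ j, ∃ d : ℤ, j ∈ W → Z * u j - u j * Z = (2 * d : ℂ) • u j := by
    intro j
    by_cases hj : j ∈ W
    · obtain ⟨d, hd⟩ := exists_eigenvalue_of_mem_siteSet hU (hu j hj)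
      exact ⟨d, fun _ => hd⟩
    · exact ⟨0, fun h => absurd h hj⟩
  -- By the Leibniz rule the one-site eigenvalues add up, so the eigenvalue of the product operator
  -- is twice an integer.
  choose d hd using hd
  refine ⟨∑ k ∈ W, d k, ?_⟩
  rw [ad_tiOp (W := W) (J := W) (fun j hj => ?_) hu1 (by simp) subset_rfl (by simp)]
  · push_cast
    rw [Finset.mul_sum, Finset.sum_smul]
    refine Finset.sum_congr rfl fun k hk => ?_
    have e1 : (fun j => Function.update (1 : ℤ → Site) 0 Z (j - k) * u j) =
        Function.update u k (Z * u k) := by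
      funext j
      rcases eq_or_ne j k with rfl | hne
      · simp
      · rw [Function.update_of_ne hne, Function.update_of_ne (sub_ne_zero.2 hne)]
        simp
    have e2 : (fun j => u j * Function.update (1 : ℤ → Site) 0 Z (j - k)) =
        Function.update u k (u k * Z) := by
      funext j
      rcases eq_or_ne j k with rfl | hne
      · simp
      · rw [Function.update_of_ne hne, Function.update_of_ne (sub_ne_zero.2 hne)]
        simp
    have e3 : Z * u k = (2 * d k : ℂ) • u k + u k * Z := by
      rw [← hd k hk, sub_add_cancel]
    rw [e1, e2, e3, tiOp, tiOp, expand_update_add hk, add_sub_cancel_right, expand_update_smul hk,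
      Function.update_eq_self]
    rfl
  · rw [Function.update_of_ne (by simpa using hj)]
    rfl

/-! ### Decompositions into product operators and their sizes -/

/-- `Q` is a linear combination, with coefficients of total size at most `B`, of translationally
invariant operators generated by products of `r + 1` neighbouring factors from `siteSet U`. -/
inductive Decomp (U : Site) (r : ℕ) : ℝ → TIOp → Prop
  | term (k : ℤ) (u : ℤ → Site) (hu : ∀ j, u j ∈ siteSet U)
      (h1 : ∀ j ∉ Finset.Icc k (k + r), u j = 1) (c : ℂ) :
      Decomp U r ‖c‖ (c • tiOp (Finset.Icc k (k + r)) u)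
  | zero : Decomp U r 0 0
  | add {B B' : ℝ} {Q Q' : TIOp} : Decomp U r B Q → Decomp U r B' Q' → Decomp U r (B + B') (Q + Q')
  | mono {B B' : ℝ} {Q : TIOp} : B ≤ B' → Decomp U r B Q → Decomp U r B' Q

namespace Decomp

variable {U : Site} {r s : ℕ} {B B' : ℝ} {Q S : TIOp}

theorem nonneg (h : Decomp U r B Q) : 0 ≤ B := by
  induction h with
  | term k u hu h1 c => exact norm_nonneg c
  | zero => exact le_rfl
  | add _ _ h h' => exact add_nonneg h h'
  | mono hB _ h => exact h.trans hB

theorem smul (h : Decomp U r B Q) (c : ℂ) : Decomp U r (‖c‖ * B) (c • Q) := by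
  induction h with
  | term k u hu h1 d =>
    rw [smul_smul, ← norm_mul]
    exact term k u hu h1 _
  | zero => simpa using zero
  | add _ _ h h' =>
    rw [mul_add, smul_add]
    exact h.add h'
  | mono hB _ h => exact mono (mul_le_mul_of_nonneg_left hB (norm_nonneg c)) h

theorem sum {ι : Type*} (F : Finset ι) {b : ι → ℝ} {q : ι → TIOp}
    (h : ∀ i ∈ F, Decomp U r (b i) (q i)) : Decomp U r (∑ i ∈ F, b i) (∑ i ∈ F, q i) := by
  classical
  induction F using Finset.induction_on with
  | empty => simpa using zero
  | insert i F hi ih =>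
    rw [Finset.sum_insert hi, Finset.sum_insert hi]
    exact (h i (Finset.mem_insert_self _ _)).add (ih fun j hj => h j (Finset.mem_insert_of_mem hj))

theorem mem_rangeSpace (h : Decomp U r B Q) : Q ∈ rangeSpace (r + 1) := by
  induction h with
  | term k u hu h1 c => exact Submodule.smul_mem _ _ (tiOp_mem_rangeSpace k r u)
  | zero => exact Submodule.zero_mem _
  | add _ _ h h' => exact Submodule.add_mem _ h h'
  | mono _ _ h => exact h

theorem frobNorm_le (hU : U.conjTranspose * U = 1) (h : Decomp U r B Q) : frobNorm Q ≤ B := by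
  induction h with
  | term k u hu h1 c =>
    rw [frobNorm_smul]
    exact mul_le_of_le_one_right (norm_nonneg c)
      (frobNorm_tiOp_le_one fun j _ => isMixed_of_mem_siteSet hU (hu j))
  | zero => exact frobNorm_zero.le
  | add _ _ h h' => exact (frobNorm_add_le _ _).trans (add_le_add h h')
  | mono hB _ h => exact h.trans hB

theorem of_tiOp {W : Finset ℤ} {k : ℤ} {u : ℤ → Site} (hW : Finset.Icc k (k + r) ⊆ W)
    (hu : ∀ j, u j ∈ siteSet U) (h1 : ∀ j ∉ Finset.Icc k (k + r), u j = 1) :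
    Decomp U r 1 (tiOp W u) := by
  have h := term k u hu h1 1
  rw [norm_one, one_smul] at h
  rwa [tiOp, expand_mono hW h1]

/-- The commutator of two strings of `r + 1` and `s + 1` sites has at most `2 (r + s + 1)` terms. -/
theorem ad_tiOp (hU : U.conjTranspose * U = 1) {k l : ℤ} {u v : ℤ → Site}
    (hu : ∀ j, u j ∈ siteSet U) (hu1 : ∀ j ∉ Finset.Icc k (k + s), u j = 1)
    (hv : ∀ j, v j ∈ siteSet U) (hv1 : ∀ j ∉ Finset.Icc l (l + r), v j = 1) :
    Decomp U (r + s) (2 * (r + s + 1))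
      (ad (tiOp (Finset.Icc k (k + s)) u) (tiOp (Finset.Icc l (l + r)) v)) := by
  rw [SpinChain.ad_tiOp (W := Finset.Icc (l - s) (l + r + s))
    (J := Finset.Icc (l - k - s) (l - k + r)) hu1 hv1 ?_ ?_ ?_]
  · have key : ∀ i ∈ Finset.Icc (l - k - s) (l - k + r),
        Decomp U (r + s) (1 + 1)
          (tiOp (Finset.Icc (l - s) (l + r + s)) (fun j => u (j - i) * v j) -
            tiOp (Finset.Icc (l - s) (l + r + s)) (fun j => v j * u (j - i))) := by
      intro i hi
      rw [Finset.mem_Icc] at hi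
      -- For `i` in this range the two intervals overlap, so their union fits into `r + s + 1`
      -- consecutive sites starting at the smaller left end.
      have h1 : ∀ j ∉ Finset.Icc (min (k + i) l) (min (k + i) l + (r + s : ℕ)),
          u (j - i) = 1 ∧ v j = 1 := by
        intro j hj
        rw [Finset.mem_Icc] at hj
        push_cast at hj
        constructor
        · refine hu1 _ ?_
          rw [Finset.mem_Icc]
          omega
        · refine hv1 _ ?_
          rw [Finset.mem_Icc]
          omega
      have hW : Finset.Icc (min (k + i) l) (min (k + i) l + (r + s : ℕ)) ⊆
          Finset.Icc (l - s) (l + r + s) := by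
        refine Finset.Icc_subset_Icc ?_ ?_
        · omega
        · push_cast
          omega
      rw [sub_eq_add_neg]
      refine add (of_tiOp hW (fun j => mul_mem_siteSet hU (hu _) (hv _)) fun j hj => ?_) ?_
      · rw [(h1 j hj).1, (h1 j hj).2, one_mul]
      · have h2 : Decomp U (r + s) 1
            (tiOp (Finset.Icc (l - s) (l + r + s)) (fun j => v j * u (j - i))) :=
          of_tiOp hW (fun j => mul_mem_siteSet hU (hv _) (hu _)) fun j hj => by
            rw [(h1 j hj).1, (h1 j hj).2, one_mul]
        simpa using h2.smul (-1)
    refine mono (le_of_eq ?_) (sum _ key)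
    rw [Finset.sum_const, Int.card_Icc, nsmul_eq_mul]
    have : (l - k + r + 1 - (l - k - s)).toNat = r + s + 1 := by omega
    rw [this]
    push_cast
    ring
  · intro x hx
    obtain ⟨y, hy, z, hz, rfl⟩ := Finset.mem_sub.1 hx
    rw [Finset.mem_Icc] at *
    omega
  · exact Finset.Icc_subset_Icc (by omega) (by omega)
  · intro i hi j hj
    rw [Finset.mem_Icc] at *
    omega

theorem ad (hU : U.conjTranspose * U = 1) (hS : Decomp U s B' S) (hQ : Decomp U r B Q) :
    Decomp U (r + s) (2 * (r + s + 1) * (B' * B)) (ad S Q) := by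
  induction hS with
  | term k u hu hu1 c =>
    induction hQ with
    | term l v hv hv1 d =>
      rw [← adLinear_apply, map_smul, map_smul, LinearMap.smul_apply, adLinear_apply, smul_smul,
        mul_comm, mul_comm ‖c‖, ← norm_mul]
      exact (ad_tiOp hU hu hu1 hv hv1).smul _
    | zero => simpa using zero
    | add _ _ h h' =>
      rw [map_add]
      exact mono (le_of_eq (by ring)) (h.add h')
    | mono hB _ h => exact mono (by gcongr) h
  | zero =>
    rw [← adLinear_apply, map_zero, LinearMap.zero_apply, zero_mul, mul_zero]
    exact zero
  | add _ _ h h' =>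
    rw [← adLinear_apply, map_add, LinearMap.add_apply, add_mul, mul_add]
    exact h.add h'
  | mono hB _ h =>
    have := hQ.nonneg
    exact mono (by gcongr) h

theorem iad (hU : U.conjTranspose * U = 1) (hS : Decomp U s B' S) (hQ : Decomp U r B Q) :
    Decomp U (r + s) (2 * (r + s + 1) * (B' * B)) (iad S Q) := by
  have h := (hS.ad hU hQ).smul Complex.I
  rwa [Complex.norm_I, one_mul] at h

end Decomp

/-! ### The uniform field and its spectral gap -/

/-- The operator `∑_j σ_j` with `σ` the third Pauli matrix in a rotated frame. -/
def field (U : Site) : TIOp := tiOp {0} (Function.update (1 : ℤ → Site) 0 (rot U !![1, 0; 0, -1]))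

theorem decomp_field {U : Site} (hU : U.conjTranspose * U = 1) : Decomp U 0 1 (field U) := by
  refine Decomp.of_tiOp (k := 0) (by simp) (fun j => ?_) fun j hj => ?_
  · rcases eq_or_ne j 0 with rfl | hne
    · rw [Function.update_self]
      exact diag_mem_siteSet U (α := 0) (β := 1) (by simp) (by simp)
    · rw [Function.update_of_ne hne]
      exact one_mem_siteSet hU
  · rw [Function.update_of_ne (by simpa using hj)]
    rfl

/-- The spectral gap of the commutator with a uniform field: an operator is split into a part in
the kernel and a part on which the commutator is inverted. -/
theorem Decomp.exists_preimage {U : Site} (hU : U.conjTranspose * U = 1) {Γ : ℝ} (hΓ : 0 < Γ)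
    {r : ℕ} {B : ℝ} {Q : TIOp} (h : Decomp U r B Q) :
    ∃ x x' z : TIOp, Decomp U r (B / (2 * Γ)) x ∧
      Q = SpinChain.ad ((Γ : ℂ) • field U) x + z ∧
      x = SpinChain.ad ((Γ : ℂ) • field U) x' ∧ SpinChain.ad ((Γ : ℂ) • field U) z = 0 := by
  have hsm : ∀ y, SpinChain.ad ((Γ : ℂ) • field U) y = (Γ : ℂ) • SpinChain.ad (field U) y := by
    intro y
    rw [← adLinear_apply, map_smul]
    rfl
  induction h with
  | term k u hu h1 c =>
    obtain ⟨d, hd⟩ := ad_field_tiOp hU (fun j _ => hu j) h1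
    change SpinChain.ad (field U) _ = _ at hd
    have hev : ∀ e : ℂ, SpinChain.ad ((Γ : ℂ) • field U) (e • tiOp (Finset.Icc k (k + r)) u) =
        (e * (2 * Γ * d)) • tiOp (Finset.Icc k (k + r)) u := by
      intro e
      rw [hsm, map_smul, hd, smul_smul, smul_smul]
      congr 1
      ring
    by_cases h0 : d = 0
    · refine ⟨0, 0, _, Decomp.zero.mono (by positivity), by rw [map_zero, zero_add], by simp, ?_⟩
      rw [hev, h0]
      simp
    · have hΓ0 : (Γ : ℂ) ≠ 0 := by exact_mod_cast hΓ.ne'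
      have hd0 : (d : ℂ) ≠ 0 := by exact_mod_cast h0
      -- The eigenvalue `2Γd` has modulus at least `2Γ` because `d` is a nonzero integer. Dividing
      -- once more gives `x'`, which shows that `x` lies in the range of the commutator.
      refine ⟨(c / (2 * Γ * d)) • tiOp (Finset.Icc k (k + r)) u,
        (c / (2 * Γ * d) / (2 * Γ * d)) • tiOp (Finset.Icc k (k + r)) u, 0, ?_, ?_, ?_, ?_⟩
      · refine (Decomp.term k u hu h1 _).mono ?_
        rw [norm_div]
        refine div_le_div_of_nonneg_left (norm_nonneg c) (by positivity) ?_
        rw [norm_mul, norm_mul, Complex.norm_ofNat, Complex.norm_real, Real.norm_of_nonneg hΓ.le,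
          Complex.norm_intCast]
        have : (1 : ℝ) ≤ |(d : ℝ)| := by exact_mod_cast Int.one_le_abs h0
        nlinarith
      · rw [hev, add_zero]
        congr 1
        field_simp
      · rw [hev]
        congr 1
        field_simp
      · rw [map_zero]
  | zero => exact ⟨0, 0, 0, by simpa using Decomp.zero, by simp, by simp, by simp⟩
  | add _ _ h h' =>
    obtain ⟨x, x', z, hx, hQ, hx', hz⟩ := h
    obtain ⟨y, y', w, hy, hQ', hy', hw⟩ := h'
    refine ⟨x + y, x' + y', z + w, ?_, ?_, ?_, ?_⟩
    · rw [add_div]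
      exact hx.add hy
    · rw [map_add, hQ, hQ']
      abel
    · rw [map_add, ← hx', ← hy']
    · rw [map_add, hz, hw, add_zero]
  | mono hB _ h =>
    obtain ⟨x, x', z, hx, hQ⟩ := h
    exact ⟨x, x', z, hx.mono (by gcongr), hQ⟩

/-! ### Symmetry of the commutator with the field, and the pseudoinverse -/

theorem letterPhase_commutator_conj (c β : Letter) :
    star (letterPhase c β - letterPhase β c) =
      letterPhase c (c + β) - letterPhase (c + β) c := by
  have e : (1 + 1 : ZMod 2) = 0 := rfl
  rcases letter_cases c with rfl | rfl | rfl | rfl <;>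
    rcases letter_cases β with rfl | rfl | rfl | rfl <;>
    simp only [letterPhase, Prod.mk_add_mk, add_zero, zero_add, e, pauli_I, pauli_X, pauli_Y,
      pauli_Z] <;>
    simp [Matrix.trace, Fin.sum_univ_two, sub_eq_add_neg]

theorem shift_single (k j : ℤ) (c : Letter) :
    shift k (Finsupp.single j c) = Finsupp.single (j + k) c := by
  simp [shift, Finsupp.equivMapDomain_single]

theorem phase_single_left {j : ℤ} {c : Letter} (b : PString) :
    phase (Finsupp.single j c) b = letterPhase c (b j) := by
  classical
  rw [phase_eq_prod (W := insert j b.support) ?_ (Finset.subset_insert _ _),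
    Finset.prod_eq_single j]
  · simp
  · intro i _ hne
    rw [Finsupp.single_eq_of_ne hne, letterPhase_zero_left]
  · simp
  · exact Finsupp.support_single_subset.trans (by simp)

theorem phase_single_right {j : ℤ} {c : Letter} (b : PString) :
    phase b (Finsupp.single j c) = letterPhase (b j) c := by
  classical
  rw [phase_eq_prod (W := insert j b.support) (Finset.subset_insert _ _) ?_,
    Finset.prod_eq_single j]
  · simp
  · intro i _ hne
    rw [Finsupp.single_eq_of_ne hne, letterPhase_zero_right]
  · simp
  · exact Finsupp.support_single_subset.trans (by simp)

/-- A single-site letter that fails to commute with `b` at site `j` differs from the nonzero letter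
`b j`, so their sum is again nonzero. The product string has the same support as `b` and remains
gauge fixed. -/
theorem bracketString_single_apply (c : Letter) (b g : GString) {W : Finset ℤ}
    (hW : b.1.support ⊆ W) :
    bracketString (Finsupp.single 0 c) b.1 g = ∑ j ∈ W,
      if Finsupp.single j c + b.1 = g.1 then
        letterPhase c (b.1 j) - letterPhase (b.1 j) c else 0 := by
  classical
  rw [bracketString_eq_sum (J := W), Finsupp.finsetSum_apply]
  · refine Finset.sum_congr rfl fun j _ => ?_
    rw [shift_single, zero_add, phase_single_left, phase_single_right, Finsupp.smul_apply,
      smul_eq_mul]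
    by_cases h0 : letterPhase c (b.1 j) - letterPhase (b.1 j) c = 0
    · simp [h0]
    have hb : b.1 j ≠ 0 := by
      intro hb
      rw [hb, letterPhase_zero_left, letterPhase_zero_right, sub_self] at h0
      exact h0 rfl
    have hc : c + b.1 j ≠ 0 := by
      intro hc
      have : b.1 j = c := by
        rw [(letter_eq_add_iff c (b.1 j) 0).1 hc.symm, add_zero]
      rw [this, sub_self] at h0
      exact h0 rfl
    have hg : (Finsupp.single j c + b.1 : PString) 0 ≠ 0 ∧
        ∀ i < 0, (Finsupp.single j c + b.1 : PString) i = 0 := by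
      constructor
      · rcases eq_or_ne j 0 with rfl | hne
        · simpa using hc
        · simpa [Finsupp.single_eq_of_ne hne.symm] using b.2.1
      · intro i hi
        have hne : i ≠ j := by
          rintro rfl
          exact hb (b.2.2 i hi)
        simpa [Finsupp.single_eq_of_ne hne] using b.2.2 i hi
    have e := gaugeFix_coe ⟨_, hg⟩
    simp only at e
    rw [e, Finsupp.single_apply, mul_ite, mul_one, mul_zero]
    simp only [Subtype.ext_iff]
  · intro x hx
    obtain ⟨y, hy, z, hz, rfl⟩ := Finset.mem_sub.1 hx
    have : z = 0 := by
      simpa using Finsupp.support_single_subset hz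
    rw [this, sub_zero]
    exact hW hy

/-- These are the matrix elements of a one-site commutator in the string basis. Adding the letter is
an involution, so it leads from `b` to `g` at site `j` exactly when it leads back, and the two phase
differences are conjugate. -/
theorem bracketString_single_conj (c : Letter) (b g : GString) :
    star (bracketString (Finsupp.single 0 c) b.1 g) = bracketString (Finsupp.single 0 c) g.1 b := by
  classical
  rw [bracketString_single_apply c b g (W := b.1.support ∪ g.1.support) Finset.subset_union_left,
    bracketString_single_apply c g b (W := b.1.support ∪ g.1.support) Finset.subset_union_right,
    star_sum]
  refine Finset.sum_congr rfl fun j _ => ?_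
  by_cases h : Finsupp.single j c + b.1 = g.1
  · have h' : Finsupp.single j c + g.1 = b.1 := by
      rw [← h, ← add_assoc, string_add_self, zero_add]
    rw [if_pos h, if_pos h', letterPhase_commutator_conj]
    have e : g.1 j = c + b.1 j := by
      rw [← h]
      simp
    rw [e]
  · have h' : Finsupp.single j c + g.1 ≠ b.1 := by
      rintro h'
      apply h
      rw [← h', ← add_assoc, string_add_self, zero_add]
    rw [if_neg h, if_neg h', star_zero]

theorem toHilbert_apply (Q : TIOp) (a : GString) : toHilbert Q a = Q a := by
  classical
  induction Q using Finsupp.induction_linear with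
  | zero => simp
  | add f g hf hg => simp [map_add, hf, hg]
  | single b c =>
    rw [toHilbert_single, lp.single_apply, Finsupp.single_apply, Pi.single_apply]
    simp only [eq_comm]

theorem frobInner_single_left (b : GString) (Q : TIOp) :
    frobInner (Finsupp.single b 1) Q = Q b := by
  classical
  rw [frobInner, toHilbert_single, lp.inner_single_left, toHilbert_apply]
  simp

theorem frobInner_single_right (b : GString) (Q : TIOp) :
    frobInner Q (Finsupp.single b 1) = star (Q b) := by
  classical
  rw [frobInner, toHilbert_single, lp.inner_single_right, toHilbert_apply]
  simp

/-- The commutator with a Hermitian single-site field is symmetric. -/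
theorem frobInner_ad_left {H₀ : TIOp} (hr : H₀ ∈ rangeSpace 1) (hH : IsHermitian H₀)
    (x y : TIOp) : frobInner (ad H₀ x) y = frobInner x (ad H₀ y) := by
  have hbg : ∀ b g : GString, star (ad H₀ (Finsupp.single b 1) g) =
      ad H₀ (Finsupp.single g 1) b := by
    intro b g
    simp only [ad, Finsupp.linearCombination_single, one_smul, Finsupp.sum, Finsupp.finsetSum_apply,
      star_sum, Finsupp.smul_apply, smul_eq_mul, star_mul']
    refine Finset.sum_congr rfl fun a ha => ?_
    have ha' := (Finsupp.mem_supported ℂ H₀).1 hr ha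
    have e : a.1 = Finsupp.single 0 (a.1 0) := by
      ext1 j
      rcases lt_trichotomy j 0 with hj | rfl | hj
      · rw [a.2.2 j hj, Finsupp.single_eq_of_ne hj.ne]
      · rw [Finsupp.single_eq_same]
      · rw [ha' j (by push_cast; omega), Finsupp.single_eq_of_ne hj.ne']
    have h1 : star (H₀ a) = H₀ a := Complex.conj_eq_iff_im.2 (hH a)
    have h2 := bracketString_single_conj (a.1 0) b g
    rw [← e] at h2
    rw [h1, h2]
  simp only [frobInner]
  induction x using Finsupp.induction_linear with
  | zero => simp
  | add f g hf hg => simp only [map_add, inner_add_left, hf, hg]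
  | single b c =>
    have e : Finsupp.single b c = c • Finsupp.single b (1 : ℂ) := by simp
    rw [e]
    simp only [map_smul, inner_smul_left]
    congr 1
    induction y using Finsupp.induction_linear with
    | zero => simp
    | add f g hf hg => simp only [map_add, inner_add_right, hf, hg]
    | single g d =>
      have e : Finsupp.single g d = d • Finsupp.single g (1 : ℂ) := by simp
      rw [e]
      simp only [map_smul, inner_smul_right]
      congr 1
      change frobInner _ _ = frobInner _ _
      rw [frobInner_single_left, frobInner_single_right, hbg]

/-- The Moore–Penrose pseudoinverse of a symmetric operator. -/
theorem pinv_eq {A : Module.End ℂ TIOp}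
    (hA : ∀ x y, frobInner (A x) y = frobInner x (A y)) {y x x' z : TIOp} (hy : y = A x + z)
    (hx : x = A x') (hz : A z = 0) : pinv A y = x := by
  have hin0 : ∀ x, frobInner x 0 = 0 := fun x => by simp [frobInner]
  have hin0' : ∀ x, frobInner 0 x = 0 := fun x => by simp [frobInner]
  have hsub : ∀ x y z, frobInner x (y - z) = frobInner x y - frobInner x z := fun x y z => by
    simp [frobInner]
  have hself : ∀ w, frobInner w w = 0 → w = 0 := by
    intro w hw
    apply eq_zero_of_frobNorm_eq_zero
    rw [frobNorm]
    exact norm_eq_zero.2 (inner_self_eq_zero.1 hw)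
  have hex : ∃ x : TIOp, (∀ z, A z = 0 → frobInner z x = 0) ∧
      ∀ z, frobInner (A z) (y - A x) = 0 := by
    refine ⟨x, fun w hw => ?_, fun w => ?_⟩
    · rw [hx, ← hA, hw, hin0']
    · rw [hy, add_sub_cancel_left, hA, hz, hin0]
  rw [pinv, dif_pos hex]
  obtain ⟨h1, h2⟩ := hex.choose_spec
  set t := hex.choose
  -- `A (t - x) = z - (y - A t)` lies in the range of `A` and is orthogonal to it: `z` is in the
  -- kernel of the symmetric `A`, and `y - A t` is orthogonal to the range by the choice of `t`.
  -- Then `t - x` is both in the kernel and orthogonal to it.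
  have hAt : A (t - x) = 0 := by
    apply hself
    have h3 : A (t - x) = z - (y - A t) := by
      rw [map_sub, hy]
      abel
    conv_lhs => rw [h3]
    have h4 : frobInner (A (t - x)) (z - (y - A t)) = 0 := by
      rw [hsub, h2, hA, hz, hin0, sub_zero]
    rw [h3] at h4
    exact h4
  have h5 : t - x = 0 := by
    apply hself
    rw [hsub, h1 _ hAt, zero_sub, hx, ← hA, ← hx, hAt, hin0', neg_zero]
  exact sub_eq_zero.1 h5

/-- The preimage built atom by atom lies in the range of the symmetric operator `ad H₀` and misses
`Q` only by a kernel element, which characterizes the pseudoinverse. The size bound thus carries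
over. -/
theorem Decomp.pinv {U : Site} (hU : U.conjTranspose * U = 1) {Γ : ℝ} (hΓ : 0 < Γ) {H₀ : TIOp}
    (hH : H₀ = (Γ : ℂ) • field U) (hr : H₀ ∈ rangeSpace 1) (hherm : IsHermitian H₀)
    {r : ℕ} {B : ℝ} {Q : TIOp} (h : Decomp U r B Q) :
    Decomp U r (B / (2 * Γ)) (pinv (SpinChain.ad H₀) Q) := by
  obtain ⟨x, x', z, hx, hQ, hx', hz⟩ := h.exists_preimage hU hΓ
  rw [← hH] at hQ hx' hz
  rwa [pinv_eq (frobInner_ad_left hr hherm) hQ hx' hz]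

/-! ### Decomposition of a two-site operator -/

/-- The coefficient of an operator at a string that need not be gauge fixed. -/
def stringCoeff (Q : TIOp) (a : PString) : ℂ :=
  open Classical in if h : a 0 ≠ 0 ∧ ∀ j < 0, a j = 0 then Q ⟨a, h⟩ else 0

theorem stringCoeff_coe (Q : TIOp) (a : GString) : stringCoeff Q a.1 = Q a := by
  rw [stringCoeff, dif_pos a.2]

theorem sum_support_eq_sum_window {X : Type*} [AddCommMonoid X] {Q : TIOp} {r : ℕ}
    (hQ : Q ∈ rangeSpace (r + 1)) {f : PString → X} (hf : ∀ a, stringCoeff Q a = 0 → f a = 0) :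
    ∑ a ∈ Q.support, f a.1 = ∑ a ∈ window (Finset.Icc 0 (r : ℤ)), f a := by
  classical
  have hinj : Set.InjOn (fun a : GString => a.1) Q.support := fun a _ b _ h => Subtype.ext h
  rw [← Finset.sum_image (f := f) hinj]
  refine Finset.sum_subset ?_ ?_
  · intro b hb
    obtain ⟨a, ha, rfl⟩ := Finset.mem_image.1 hb
    rw [mem_window]
    intro j hj
    rw [Finsupp.mem_support_iff] at hj
    rw [Finset.mem_Icc]
    constructor
    · by_contra hlt
      exact hj (a.2.2 j (not_le.1 hlt))
    · by_contra hlt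
      refine hj ((Finsupp.mem_supported ℂ Q).1 hQ ha j ?_)
      push_cast
      omega
  · intro a _ ha
    refine hf a ?_
    rw [stringCoeff]
    split_ifs with h
    · by_contra hne
      exact ha (Finset.mem_image.2 ⟨⟨a, h⟩, Finsupp.mem_support_iff.2 hne, rfl⟩)
    · rfl

theorem eq_sum_window {Q : TIOp} {r : ℕ} (hQ : Q ∈ rangeSpace (r + 1)) :
    Q = ∑ a ∈ window (Finset.Icc 0 (r : ℤ)), stringCoeff Q a • gaugeFix a := by
  rw [← sum_support_eq_sum_window hQ fun a ha => by rw [ha, zero_smul]]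
  conv_lhs => rw [← Finsupp.sum_single Q]
  refine Finset.sum_congr rfl fun a _ => ?_
  rw [stringCoeff_coe, gaugeFix_coe]
  simp

theorem frobNorm_sq_eq_sum_window {Q : TIOp} {r : ℕ} (hQ : Q ∈ rangeSpace (r + 1)) :
    frobNorm Q ^ 2 = ∑ a ∈ window (Finset.Icc 0 (r : ℤ)), ‖stringCoeff Q a‖ ^ 2 := by
  rw [← sum_support_eq_sum_window hQ fun a ha => by rw [ha, norm_zero, zero_pow two_ne_zero],
    frobNorm_sq]
  exact Finset.sum_congr rfl fun a _ => by rw [stringCoeff_coe]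

theorem stringCoeff_eq_zero {Q : TIOp} {a : PString} (h : a 0 = 0) : stringCoeff Q a = 0 := by
  rw [stringCoeff, dif_neg]
  exact fun h' => h'.1 h

theorem sum_window_one {X : Type*} [AddCommMonoid X] (f : PString → X) :
    ∑ a ∈ window {0}, f a = ∑ α, f (Finsupp.single 0 α) := by
  refine Finset.sum_bij' (fun a _ => a 0) (fun α _ => Finsupp.single 0 α) ?_ ?_ ?_ ?_ ?_
  · simp
  · intro α _
    rw [mem_window]
    exact Finsupp.support_single_subset
  · intro a ha
    ext1 j
    rcases eq_or_ne j 0 with rfl | hne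
    · simp
    · rw [Finsupp.single_eq_of_ne hne]
      by_contra h0
      exact hne (Finset.mem_singleton.1
        (mem_window.1 ha (Finsupp.mem_support_iff.2 (Ne.symm h0))))
  · simp
  · intro a ha
    congr 1
    ext1 j
    rcases eq_or_ne j 0 with rfl | hne
    · simp
    · rw [Finsupp.single_eq_of_ne hne]
      by_contra h0
      exact hne (Finset.mem_singleton.1 (mem_window.1 ha (Finsupp.mem_support_iff.2 h0)))

theorem eq_pair_of_mem_window {a : PString} (ha : a ∈ window {0, 1}) :
    Finsupp.single 0 (a 0) + Finsupp.single 1 (a 1) = a := by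
  ext1 j
  rw [Finsupp.add_apply]
  rcases eq_or_ne j 0 with rfl | h0
  · rw [Finsupp.single_eq_same, Finsupp.single_eq_of_ne (by norm_num), add_zero]
  rcases eq_or_ne j 1 with rfl | h1
  · rw [Finsupp.single_eq_same, Finsupp.single_eq_of_ne (by norm_num), zero_add]
  rw [Finsupp.single_eq_of_ne h0, Finsupp.single_eq_of_ne h1, add_zero]
  by_contra hne
  have := mem_window.1 ha (Finsupp.mem_support_iff.2 (Ne.symm hne))
  simp [h0, h1] at this

theorem pair_apply_zero (α β : Letter) :
    (Finsupp.single 0 α + Finsupp.single 1 β : PString) 0 = α := by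
  rw [Finsupp.add_apply, Finsupp.single_eq_same, Finsupp.single_eq_of_ne (by norm_num), add_zero]

theorem pair_apply_one (α β : Letter) :
    (Finsupp.single 0 α + Finsupp.single 1 β : PString) 1 = β := by
  rw [Finsupp.add_apply, Finsupp.single_eq_same, Finsupp.single_eq_of_ne (by norm_num), zero_add]

theorem sum_window_two {X : Type*} [AddCommMonoid X] (f : PString → X) :
    ∑ a ∈ window {0, 1}, f a =
      ∑ α, ∑ β, f (Finsupp.single 0 α + Finsupp.single 1 β) := by
  classical
  rw [← Fintype.sum_prod_type' fun α β => f (Finsupp.single 0 α + Finsupp.single 1 β)]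
  refine Finset.sum_bij' (fun a _ => (a 0, a 1))
    (fun p _ => Finsupp.single 0 p.1 + Finsupp.single 1 p.2) ?_ ?_ ?_ ?_ ?_
  · simp
  · intro p _
    refine add_mem_window ?_ ?_ <;> rw [mem_window] <;>
      exact Finsupp.support_single_subset.trans (by simp)
  · intro a ha
    exact eq_pair_of_mem_window ha
  · intro p _
    rw [pair_apply_zero, pair_apply_one]
  · intro a ha
    rw [eq_pair_of_mem_window ha]

theorem Icc_zero_one : Finset.Icc (0 : ℤ) ((1 : ℕ) : ℤ) = {0, 1} := by
  ext j
  simp only [Finset.mem_Icc, Finset.mem_insert, Finset.mem_singleton]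
  push_cast
  omega

/-- The translationally invariant operator with the density `A ⊗ B` on two neighbouring sites. -/
def pairOp (A B : Site) : TIOp := tiOp {0, 1} fun j => if j = 0 then A else if j = 1 then B else 1

theorem pairOp_eq_sum (A B : Site) : pairOp A B = ∑ α, ∑ β,
    (component A α * component B β) • gaugeFix (Finsupp.single 0 α + Finsupp.single 1 β) := by
  rw [pairOp, tiOp, expand, sum_window_two]
  refine Finset.sum_congr rfl fun α _ => Finset.sum_congr rfl fun β _ => ?_
  rw [coef, Finset.prod_pair (by norm_num), pair_apply_zero, pair_apply_one]
  simp

/-- `pairOp` as a bilinear map. -/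
def pairOpLinear : Site →ₗ[ℂ] Site →ₗ[ℂ] TIOp :=
  LinearMap.mk₂ ℂ pairOp
    (fun A A' B => by
      simp only [pairOp_eq_sum, component_add, add_mul, add_smul, Finset.sum_add_distrib])
    (fun c A B => by
      simp only [pairOp_eq_sum, component_smul, mul_assoc, mul_smul, Finset.smul_sum])
    (fun A B B' => by
      simp only [pairOp_eq_sum, component_add, mul_add, add_smul, Finset.sum_add_distrib])
    (fun c A B => by
      simp only [pairOp_eq_sum, component_smul, mul_left_comm _ c, mul_smul, Finset.smul_sum])

theorem pairOp_sum_left {ι : Type*} (s : Finset ι) (c : ι → ℂ) (A : ι → Site) (B : Site) :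
    pairOp (∑ i ∈ s, c i • A i) B = ∑ i ∈ s, c i • pairOp (A i) B := by
  change pairOpLinear _ _ = ∑ i ∈ s, c i • pairOpLinear (A i) B
  simp only [map_sum, map_smul, LinearMap.sum_apply, LinearMap.smul_apply]

theorem pairOp_sum_right {ι : Type*} (s : Finset ι) (c : ι → ℂ) (A : Site) (B : ι → Site) :
    pairOp A (∑ i ∈ s, c i • B i) = ∑ i ∈ s, c i • pairOp A (B i) := by
  change pairOpLinear _ _ = ∑ i ∈ s, c i • pairOpLinear A (B i)
  simp only [map_sum, map_smul]

/-- The identity, the field direction, the raising and the lowering operator in a rotated frame. -/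
def frame (U : Site) : Fin 4 → Site :=
  ![1, rot U !![1, 0; 0, -1], rot U !![0, 1; 0, 0], rot U !![0, 0; 1, 0]]

/-- The coordinates of a single-site operator with respect to `frame U`. -/
def coord (U A : Site) : Fin 4 → ℂ :=
  let X := U.conjTranspose * A * U
  ![(X 0 0 + X 1 1) / 2, (X 0 0 - X 1 1) / 2, X 0 1, X 1 0]

/-- The inverse squares of the norms of the elements of `frame U`. -/
def frameWeight : Fin 4 → ℝ := ![1, 1, 2, 2]

theorem frameWeight_pos (i : Fin 4) : 0 < frameWeight i := by
  fin_cases i <;> simp [frameWeight]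

theorem rot_conjTranspose_mul {U : Site} (hU : U.conjTranspose * U = 1) (A : Site) :
    rot U (U.conjTranspose * A * U) = A := by
  have h : U * U.conjTranspose = 1 := mul_eq_one_comm.1 hU
  calc rot U (U.conjTranspose * A * U)
      = (U * U.conjTranspose) * A * (U * U.conjTranspose) := by simp only [rot, Matrix.mul_assoc]
    _ = A := by rw [h, Matrix.one_mul, Matrix.mul_one]

theorem sum_coord {U : Site} (hU : U.conjTranspose * U = 1) (A : Site) :
    ∑ i, coord U A i • frame U i = A := by
  conv_rhs => rw [← rot_conjTranspose_mul hU A]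
  have hf : frame U =
      fun i => rot U (![1, !![1, 0; 0, -1], !![0, 1; 0, 0], !![0, 0; 1, 0]] i) := by
    funext i
    fin_cases i <;> simp [frame, rot_one hU]
  simp only [Fin.sum_univ_four, hf, ← rot_smul, ← rot_add, coord, Matrix.cons_val]
  congr 1
  ext i j
  fin_cases i <;> fin_cases j <;> simp <;> ring

/-- The frame is orthogonal for the normalized trace; this is its Parseval identity. -/
theorem sum_sq_coord {U : Site} (hU : U.conjTranspose * U = 1) (A : Site) :
    ∑ i, ‖coord U A i‖ ^ 2 / frameWeight i = ∑ α, ‖component A α‖ ^ 2 := by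
  conv_rhs => rw [← rot_conjTranspose_mul hU A]
  rw [sum_sq_component_rot hU]
  have h := trace_conjTranspose_mul_self (U.conjTranspose * A * U)
  simp only [coord]
  set X := U.conjTranspose * A * U
  have h2 : (X.conjTranspose * X).trace =
      ((‖X 0 0‖ ^ 2 + ‖X 0 1‖ ^ 2 + ‖X 1 0‖ ^ 2 + ‖X 1 1‖ ^ 2 : ℝ) : ℂ) := by
    simp only [Matrix.trace, Matrix.diag, Matrix.mul_apply, Fin.sum_univ_two,
      Matrix.conjTranspose_apply, RCLike.star_def, Complex.conj_mul']
    push_cast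
    ring
  rw [h2] at h
  have h3 : ‖X 0 0‖ ^ 2 + ‖X 0 1‖ ^ 2 + ‖X 1 0‖ ^ 2 + ‖X 1 1‖ ^ 2 =
      2 * ∑ α, ‖component X α‖ ^ 2 := by exact_mod_cast h
  have h4 := parallelogram_law_with_norm ℝ (X 0 0) (X 1 1)
  simp only [Fin.sum_univ_four, frameWeight, Matrix.cons_val, norm_div, Complex.norm_ofNat]
  linarith

theorem coord_sum {U : Site} {ι : Type*} (s : Finset ι) (c : ι → ℂ) (A : ι → Site) (i : Fin 4) :
    coord U (∑ k ∈ s, c k • A k) i = ∑ k ∈ s, c k * coord U (A k) i := by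
  have h : ∀ B : Site, coord U B i = ![(rot U.conjTranspose B 0 0 + rot U.conjTranspose B 1 1) / 2,
      (rot U.conjTranspose B 0 0 - rot U.conjTranspose B 1 1) / 2, rot U.conjTranspose B 0 1,
      rot U.conjTranspose B 1 0] i := fun B => by
    rw [coord, rot, Matrix.conjTranspose_conjTranspose]
  have hl : rot U.conjTranspose (∑ k ∈ s, c k • A k) =
      ∑ k ∈ s, c k • rot U.conjTranspose (A k) := by
    simp only [rot, Finset.mul_sum, Finset.sum_mul, Matrix.mul_smul, Matrix.smul_mul]
  simp only [h, hl]
  fin_cases i <;>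
    simp [Matrix.sum_apply, Finset.sum_div, ← Finset.sum_add_distrib, ← Finset.sum_sub_distrib,
      mul_div_assoc, mul_add, mul_sub, add_div, sub_div]

theorem coord_zero_eq_component {U : Site} (hU : U.conjTranspose * U = 1) (A : Site) :
    coord U A 0 = component A 0 := by
  rw [component, ← Prod.mk_zero_zero, pauli, if_pos rfl, Matrix.one_mul]
  have h : (U.conjTranspose * A * U).trace = A.trace := by
    rw [Matrix.trace_mul_comm, ← Matrix.mul_assoc, mul_eq_one_comm.1 hU, Matrix.one_mul]
  rw [← h, Matrix.trace, Fin.sum_univ_two]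
  rfl

theorem frame_mem_siteSet {U : Site} (hU : U.conjTranspose * U = 1) (i : Fin 4) :
    frame U i ∈ siteSet U := by
  fin_cases i
  · exact one_mem_siteSet hU
  · exact diag_mem_siteSet U (α := 0) (β := 1) (by simp) (by simp)
  · exact raising_mem_siteSet U (c := 1) (by simp) (by simp)
  · exact lowering_mem_siteSet U (c := 1) (by simp) (by simp)

theorem decomp_pairOp {U : Site} (hU : U.conjTranspose * U = 1) {A B : Site} (hA : A ∈ siteSet U)
    (hB : B ∈ siteSet U) : Decomp U 1 1 (pairOp A B) := by
  refine Decomp.of_tiOp (k := 0) ?_ (fun j => ?_) fun j hj => ?_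
  · rw [zero_add, Icc_zero_one]
  · split_ifs
    · exact hA
    · exact hB
    · exact one_mem_siteSet hU
  · rw [zero_add, Icc_zero_one] at hj
    simp only [Finset.mem_insert, Finset.mem_singleton, not_or] at hj
    rw [if_neg hj.1, if_neg hj.2]

/-- A two-site operator has a decomposition of size at most `√30` times its Frobenius norm. -/
theorem decomp_of_mem_rangeSpace_two {U : Site} (hU : U.conjTranspose * U = 1) {T : TIOp}
    (hT : T ∈ rangeSpace 2) : Decomp U 1 (√30 * frobNorm T) T := by
  set t : Letter → Letter → ℂ := fun α β =>
    stringCoeff T (Finsupp.single 0 α + Finsupp.single 1 β) with ht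
  have ht0 : ∀ β, t 0 β = 0 := fun β => stringCoeff_eq_zero (pair_apply_zero 0 β)
  have hTsum : T = ∑ α, ∑ β, t α β • pairOp (pauli α) (pauli β) := by
    have h := eq_sum_window (r := 1) hT
    rw [Icc_zero_one, sum_window_two] at h
    rw [h]
    refine Finset.sum_congr rfl fun α _ => Finset.sum_congr rfl fun β _ => ?_
    rw [pairOp_eq_sum]
    simp [component_pauli, ht]
  have hTnorm : frobNorm T ^ 2 = ∑ α, ∑ β, ‖t α β‖ ^ 2 := by
    rw [frobNorm_sq_eq_sum_window (r := 1) hT, Icc_zero_one, sum_window_two]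
  set A : Letter → Site := fun β => ∑ α, t α β • pauli α with hA
  set B : Fin 4 → Site := fun i => ∑ β, coord U (A β) i • pauli β with hB
  have hTB : T = ∑ i, ∑ k, coord U (B i) k • pairOp (frame U i) (frame U k) := by
    have h1 : T = ∑ β, pairOp (A β) (pauli β) := by
      rw [hTsum, Finset.sum_comm]
      exact Finset.sum_congr rfl fun β _ => (pairOp_sum_left _ _ _ _).symm
    have h2 : ∀ β, pairOp (A β) (pauli β) =
        ∑ i, coord U (A β) i • pairOp (frame U i) (pauli β) := fun β => by
      rw [← pairOp_sum_left, sum_coord hU]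
    rw [h1, Finset.sum_congr rfl fun β _ => h2 β, Finset.sum_comm]
    refine Finset.sum_congr rfl fun i _ => ?_
    rw [← pairOp_sum_right, ← pairOp_sum_right, sum_coord hU]
  have hcomp : ∀ (c : Letter → ℂ) (α : Letter), component (∑ β, c β • pauli β) α = c α := by
    intro c α
    rw [component_sum]
    simp [component_smul, component_pauli]
  -- Gauge fixing puts a non-identity letter on the first site, so the frame element 1 never appears
  -- there.
  have hB0 : ∀ k, coord U (B 0) k = 0 := by
    have hA0 : ∀ β, coord U (A β) 0 = 0 := fun β => by
      rw [coord_zero_eq_component hU, hcomp, ht0]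
    intro k
    rw [hB, coord_sum]
    simp [hA0]
  have hnorm : ∑ i, ∑ k, ‖coord U (B i) k‖ ^ 2 / (frameWeight i * frameWeight k) =
      frobNorm T ^ 2 := by
    have h1 : ∀ i, ∑ k, ‖coord U (B i) k‖ ^ 2 / (frameWeight i * frameWeight k) =
        ∑ β, ‖coord U (A β) i‖ ^ 2 / frameWeight i := by
      intro i
      have h := sum_sq_coord hU (B i)
      simp only [hB, hcomp] at h
      rw [← Finset.sum_div, ← h, Finset.sum_div]
      refine Finset.sum_congr rfl fun k _ => ?_
      rw [div_div, mul_comm]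
    have h2 : ∀ β, ∑ i, ‖coord U (A β) i‖ ^ 2 / frameWeight i = ∑ α, ‖t α β‖ ^ 2 := by
      intro β
      rw [sum_sq_coord hU]
      simp only [hA, hcomp]
    calc _ = ∑ i, ∑ β, ‖coord U (A β) i‖ ^ 2 / frameWeight i := Finset.sum_congr rfl fun i _ => h1 i
      _ = ∑ β, ∑ i, ‖coord U (A β) i‖ ^ 2 / frameWeight i := Finset.sum_comm
      _ = ∑ β, ∑ α, ‖t α β‖ ^ 2 := Finset.sum_congr rfl fun β _ => h2 β
      _ = frobNorm T ^ 2 := by rw [hTnorm, Finset.sum_comm]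
  -- Weighted Cauchy–Schwarz without the terms `i = 0`: the weights sum to `(1 + 2 + 2)(1 + 1 + 2 +
  -- 2) = 30`.
  have hcs : (∑ i, ∑ k, ‖coord U (B i) k‖) ^ 2 ≤ 30 * frobNorm T ^ 2 := by
    have h : (∑ p : Fin 4 × Fin 4, ‖coord U (B p.1) p.2‖) ^ 2 ≤
        (∑ p : Fin 4 × Fin 4, if p.1 = 0 then 0 else frameWeight p.1 * frameWeight p.2) *
          ∑ p : Fin 4 × Fin 4,
            ‖coord U (B p.1) p.2‖ ^ 2 / (frameWeight p.1 * frameWeight p.2) := by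
      refine Finset.sum_sq_le_sum_mul_sum_of_sq_le_mul _ ?_ ?_ ?_
      · intro p _
        have h1 := frameWeight_pos p.1
        have h2 := frameWeight_pos p.2
        split_ifs <;> positivity
      · intro p _
        have h1 := frameWeight_pos p.1
        have h2 := frameWeight_pos p.2
        positivity
      · intro p _
        have h1 := frameWeight_pos p.1
        have h2 := frameWeight_pos p.2
        split_ifs with h0
        · rw [h0, hB0]
          simp
        · exact le_of_eq (by field_simp)
    rw [Fintype.sum_prod_type, Fintype.sum_prod_type, Fintype.sum_prod_type, hnorm] at h
    refine h.trans_eq ?_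
    congr 1
    simp [Fin.sum_univ_four, frameWeight]
    norm_num
  have hle : ∑ i, ∑ k, ‖coord U (B i) k‖ ≤ √30 * frobNorm T := by
    refine abs_le_of_sq_le_sq' ?_ (by have := frobNorm_nonneg T; positivity) |>.2
    rwa [mul_pow, Real.sq_sqrt (by norm_num)]
  refine Decomp.mono hle ?_
  rw [hTB]
  refine Decomp.sum _ fun i _ => Decomp.sum _ fun k _ => ?_
  have h := (decomp_pairOp hU (frame_mem_siteSet hU i) (frame_mem_siteSet hU k)).smul
    (coord U (B i) k)
  rwa [mul_one] at h

/-! ### A Hermitian one-site operator as a uniform field -/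

/-- A real vector is rotated to the third axis. -/
theorem exists_rotation {x y z Γ : ℝ} (hΓ : 0 < Γ) (h : x ^ 2 + y ^ 2 + z ^ 2 = Γ ^ 2) :
    ∃ U : Site, U.conjTranspose * U = 1 ∧
      (Γ : ℂ) • rot U !![1, 0; 0, -1] =
        !![(z : ℂ), x - y * Complex.I; x + y * Complex.I, -z] := by
  have hz : -Γ ≤ z := by nlinarith [sq_nonneg x, sq_nonneg y]
  -- The opposite direction `z = -Γ` is separate, since the normalization below would vanish; there
  -- the swap `X` does it.
  rcases hz.eq_or_lt with hz | hz
  · have hxy : x ^ 2 + y ^ 2 = 0 := by rw [← hz] at h; linarith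
    have hx : x = 0 := by nlinarith [sq_nonneg x, sq_nonneg y]
    have hy : y = 0 := by nlinarith [sq_nonneg x, sq_nonneg y]
    refine ⟨!![0, 1; 1, 0], ?_, ?_⟩
    · ext i j
      fin_cases i <;> fin_cases j <;> simp [Matrix.mul_apply]
    · subst hx hy
      have hc : (!![0, 1; 1, 0] : Site).conjTranspose = !![0, 1; 1, 0] := by
        ext i j
        fin_cases i <;> fin_cases j <;> simp
      rw [← hz, rot, hc]
      ext i j
      fin_cases i <;> fin_cases j <;> simp
  · have hp : 0 < 2 * Γ * (Γ + z) := by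
      have : 0 < Γ + z := by linarith
      positivity
    set N := √(2 * Γ * (Γ + z)) with hN
    have hN0 : (N : ℂ) ≠ 0 := by exact_mod_cast (Real.sqrt_pos.2 hp).ne'
    have hNsq : (N : ℂ) ^ 2 = 2 * Γ * (Γ + z) := by exact_mod_cast Real.sq_sqrt hp.le
    have hc : (x : ℂ) ^ 2 + y ^ 2 + z ^ 2 = Γ ^ 2 := by exact_mod_cast h
    -- With `M` the target matrix, `M² = Γ²`, and `V = Γ + M Z` intertwines: `M V = Γ V Z`. It is
    -- unitary up to the factor `N`, where `N² = 2Γ(Γ + z)`.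
    set V : Site := !![(Γ + z : ℂ), -(x - y * Complex.I); x + y * Complex.I, Γ + z] with hV
    have hI := Complex.I_sq
    have hVc : V.conjTranspose =
        !![(Γ + z : ℂ), x - y * Complex.I; -(x + y * Complex.I), Γ + z] := by
      ext i j
      fin_cases i <;> fin_cases j <;> simp [hV, sub_eq_add_neg]
    have hVV : V.conjTranspose * V = ((N : ℂ) ^ 2) • (1 : Site) := by
      rw [hNsq, hVc, hV]
      ext i j
      fin_cases i <;> fin_cases j <;> simp <;>
        first
        | ring1
        | linear_combination hc - (y : ℂ) ^ 2 * hI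
    have hVZ : (Γ : ℂ) • (V * !![1, 0; 0, -1] * V.conjTranspose) =
        ((N : ℂ) ^ 2) • !![(z : ℂ), x - y * Complex.I; x + y * Complex.I, -z] := by
      rw [hNsq, hVc, hV]
      ext i j
      fin_cases i <;> fin_cases j <;> simp <;>
        first
        | ring1
        | linear_combination (-(Γ : ℂ)) * (hc - (y : ℂ) ^ 2 * hI)
        | linear_combination (Γ : ℂ) * (hc - (y : ℂ) ^ 2 * hI)
    have hstar : star ((N : ℂ)⁻¹) = (N : ℂ)⁻¹ := by simp
    refine ⟨(N : ℂ)⁻¹ • V, ?_, ?_⟩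
    · rw [Matrix.conjTranspose_smul, Matrix.smul_mul, Matrix.mul_smul, hVV, hstar, smul_smul,
        smul_smul]
      field_simp
      rw [one_smul]
    · rw [rot, Matrix.conjTranspose_smul, Matrix.smul_mul, Matrix.smul_mul, Matrix.mul_smul, hstar,
        smul_comm (Γ : ℂ), smul_comm (Γ : ℂ), hVZ, smul_smul, smul_smul]
      field_simp
      rw [one_smul]

/-- A Hermitian single-site operator is a uniform field. -/
theorem exists_eq_smul_field {H₀ : TIOp} (hr : H₀ ∈ rangeSpace 1) (hH : IsHermitian H₀)
    (hpos : 0 < frobNorm H₀) :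
    ∃ U : Site, U.conjTranspose * U = 1 ∧ H₀ = (frobNorm H₀ : ℂ) • field U := by
  have hI : Finset.Icc (0 : ℤ) ((0 : ℕ) : ℤ) = {0} := by simp
  set q : Letter → ℂ := fun α => stringCoeff H₀ (Finsupp.single 0 α) with hq
  have hsum : H₀ = ∑ α, q α • gaugeFix (Finsupp.single 0 α) := by
    have h := eq_sum_window (r := 0) hr
    rwa [hI, sum_window_one] at h
  have hnorm : frobNorm H₀ ^ 2 = ∑ α, ‖q α‖ ^ 2 := by
    rw [frobNorm_sq_eq_sum_window (r := 0) hr, hI, sum_window_one]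
  have hreal : ∀ α, ((q α).re : ℂ) = q α := by
    intro α
    apply Complex.ext
    · simp
    · simp only [Complex.ofReal_im, hq, stringCoeff]
      split_ifs
      · exact (hH _).symm
      · simp
  have hq0 : q (0, 0) = 0 := stringCoeff_eq_zero (by simp)
  have hre : ∀ α, ‖q α‖ ^ 2 = (q α).re ^ 2 := fun α => by
    rw [← hreal α, Complex.norm_real, Complex.ofReal_re, Real.norm_eq_abs, sq_abs]
  have hxyz : (q (1, 0)).re ^ 2 + (q (1, 1)).re ^ 2 + (q (0, 1)).re ^ 2 = frobNorm H₀ ^ 2 := by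
    rw [hnorm, sum_letter, hq0]
    simp [hre]
  obtain ⟨U, hU, hUZ⟩ := exists_rotation hpos hxyz
  refine ⟨U, hU, ?_⟩
  have hf : (frobNorm H₀ : ℂ) • field U =
      tiOp {0} (Function.update (1 : ℤ → Site) 0 ((frobNorm H₀ : ℂ) • rot U !![1, 0; 0, -1])) := by
    rw [tiOp, expand_update_smul (by simp)]
    rfl
  rw [hf, hUZ, tiOp, expand, sum_window_one]
  conv_lhs => rw [hsum]
  refine Finset.sum_congr rfl fun α _ => ?_
  congr 1
  rw [coef, Finset.prod_singleton, Function.update_self, Finsupp.single_eq_same]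
  rcases letter_cases α with rfl | rfl | rfl | rfl
  · rw [component_I, hq0]
    simp
  · rw [component_X]
    simp [hreal]
  · rw [component_Y, ← hreal]
    simp
    linear_combination ((q (1, 1)).re : ℂ) * Complex.I_sq
  · rw [component_Z]
    simp [hreal]

/-! ### Increasing tuples and multiplicity vectors -/

/-- The increasing list in which the number `l + 1` has the multiplicity `q l`. -/
def sortedList {n : ℕ} (q : Fin n → ℕ) : List ℕ :=
  (List.ofFn fun l : Fin n => List.replicate (q l) ((l : ℕ) + 1)).flatten

theorem count_ofFn {p : ℕ} (k : Fin p → ℕ) (a : ℕ) :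
    (List.ofFn k).count a = (Finset.univ.filter fun i => k i = a).card := by
  rw [Finset.card_filter]
  induction p with
  | zero => simp
  | succ p ih =>
    rw [List.ofFn_succ, List.count_cons, ih, Fin.sum_univ_succ, add_comm]
    congr 1
    simp

section

variable {n : ℕ} (q : Fin n → ℕ)

theorem length_sortedList : (sortedList q).length = ∑ l, q l := by
  rw [sortedList, List.length_flatten, List.map_ofFn, List.sum_ofFn]
  simp

theorem sum_sortedList : (sortedList q).sum = ∑ l : Fin n, ((l : ℕ) + 1) * q l := by
  rw [sortedList, List.sum_flatten, List.map_ofFn, List.sum_ofFn]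
  simp [mul_comm]

theorem prod_map_sortedList {R : Type*} [CommMonoid R] (f : ℕ → R) :
    ((sortedList q).map f).prod = ∏ l : Fin n, f ((l : ℕ) + 1) ^ q l := by
  rw [sortedList, List.map_flatten, List.prod_flatten, List.map_ofFn, List.map_ofFn,
    List.prod_ofFn]
  simp

theorem count_sortedList (a : ℕ) :
    (sortedList q).count a = ∑ l : Fin n, if (l : ℕ) + 1 = a then q l else 0 := by
  rw [sortedList, List.count_flatten, List.map_ofFn, List.sum_ofFn]
  simp [List.count_replicate]

theorem count_sortedList_succ (l : Fin n) : (sortedList q).count ((l : ℕ) + 1) = q l := by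
  rw [count_sortedList, Finset.sum_eq_single l]
  · simp
  · intro i _ hne
    rw [if_neg]
    intro h
    exact hne (Fin.ext (by omega))
  · simp

theorem mem_sortedList {a : ℕ} (h : a ∈ sortedList q) : 1 ≤ a ∧ a ≤ n := by
  rw [sortedList, List.mem_flatten] at h
  obtain ⟨L, hL, ha⟩ := h
  obtain ⟨l, rfl⟩ := List.mem_ofFn.1 hL
  rw [List.eq_of_mem_replicate ha]
  omega

theorem sortedLE_sortedList : (sortedList q).SortedLE := by
  rw [List.sortedLE_iff_pairwise, sortedList, List.pairwise_flatten]
  constructor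
  · intro L hL
    obtain ⟨l, rfl⟩ := List.mem_ofFn.1 hL
    exact List.pairwise_replicate.2 (Or.inr le_rfl)
  · rw [List.pairwise_ofFn]
    intro i j hij x hx y hy
    rw [List.eq_of_mem_replicate hx, List.eq_of_mem_replicate hy]
    have : (i : ℕ) < j := hij
    omega

end

/-- The multiplicities of tuples of length `p` and sum `m` with entries in `1, …, n`. -/
def mults (n p m : ℕ) : Finset (Fin n → ℕ) :=
  (Finset.univ.piAntidiag p).filter fun q => ∑ l : Fin n, ((l : ℕ) + 1) * q l = m

theorem mem_mults {n p m : ℕ} {q : Fin n → ℕ} :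
    q ∈ mults n p m ↔ ∑ l, q l = p ∧ ∑ l : Fin n, ((l : ℕ) + 1) * q l = m := by
  simp [mults]

theorem mem_tuples {n p m : ℕ} {k : Fin p → ℕ} :
    k ∈ tuples n p m ↔ (∀ i, 1 ≤ k i ∧ k i ≤ n) ∧ ∑ i, k i = m := by
  simp [tuples]

/-- Two sorted lists with equal multiplicities coincide. -/
theorem sortedList_eq_ofFn {n p m : ℕ} {k : Fin p → ℕ} (hk : k ∈ tuples n p m)
    (hmono : Monotone k) :
    sortedList (fun l : Fin n => (Finset.univ.filter fun i => k i = (l : ℕ) + 1).card) =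
      List.ofFn k := by
  refine List.Perm.eq_of_sortedLE (sortedLE_sortedList _) (List.sortedLE_ofFn_iff.2 hmono) ?_
  rw [List.perm_iff_count]
  intro a
  rw [count_ofFn]
  by_cases ha : 1 ≤ a ∧ a ≤ n
  · have h := count_sortedList_succ
      (fun l : Fin n => (Finset.univ.filter fun i => k i = (l : ℕ) + 1).card) ⟨a - 1, by omega⟩
    have e : a - 1 + 1 = a := by omega
    simpa only [e] using h
  · rw [List.count_eq_zero_of_not_mem fun h => ha (mem_sortedList _ h), eq_comm,
      Finset.card_eq_zero, Finset.filter_eq_empty_iff]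
    rintro i _ rfl
    exact ha ((mem_tuples.1 hk).1 i)

/-- Sums over increasing tuples are sums over multiplicities. -/
theorem sum_tuples_weight {X : Type*} [AddCommGroup X] [Module ℂ X] (n p m : ℕ)
    (F : List ℕ → X) :
    ∑ k ∈ tuples n p m, weight n k • F (List.ofFn k) =
      ∑ q ∈ mults n p m, (1 / ((∏ l, (q l)! : ℕ) : ℂ)) • F (sortedList q) := by
  classical
  have h0 : ∑ k ∈ tuples n p m, weight n k • F (List.ofFn k) =
      ∑ k ∈ (tuples n p m).filter fun k => Monotone k, weight n k • F (List.ofFn k) := by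
    symm
    refine Finset.sum_subset (Finset.filter_subset _ _) fun k hk hk' => ?_
    have : ¬ Monotone k := fun h => hk' (Finset.mem_filter.2 ⟨hk, h⟩)
    rw [weight, if_neg this, zero_smul]
  -- The list has length exactly `p`, so the default value 0 is never read.
  have hinv : ∀ q ∈ mults n p m,
      List.ofFn (fun i : Fin p => (sortedList q).getD i 0) = sortedList q := by
    intro q hq
    have hlen : (sortedList q).length = p := by rw [length_sortedList, (mem_mults.1 hq).1]
    apply List.ext_getElem
    · rw [List.length_ofFn, hlen]
    · intro i h1 h2
      rw [List.getElem_ofFn, List.getD_eq_getElem _ _ h2]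
  rw [h0]
  refine Finset.sum_bij'
    (fun k _ => fun l : Fin n => (Finset.univ.filter fun i => k i = (l : ℕ) + 1).card)
    (fun q _ => fun i : Fin p => (sortedList q).getD i 0) ?_ ?_ ?_ ?_ ?_
  · intro k hk
    obtain ⟨hk, hmono⟩ := Finset.mem_filter.1 hk
    have e := sortedList_eq_ofFn hk hmono
    rw [mem_mults, ← length_sortedList, ← sum_sortedList, e, List.length_ofFn, List.sum_ofFn]
    exact ⟨rfl, (mem_tuples.1 hk).2⟩
  · intro q hq
    have e := hinv q hq
    rw [Finset.mem_filter, mem_tuples, ← List.sortedLE_ofFn_iff, ← List.sum_ofFn, e,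
      sum_sortedList, (mem_mults.1 hq).2]
    refine ⟨⟨fun i => ?_, rfl⟩, sortedLE_sortedList q⟩
    apply mem_sortedList q
    rw [← e]
    exact List.mem_ofFn.2 ⟨i, by rw [e]⟩
  · intro k hk
    obtain ⟨hk, hmono⟩ := Finset.mem_filter.1 hk
    funext i
    rw [sortedList_eq_ofFn hk hmono, List.getD_eq_getElem _ _ (by simp), List.getElem_ofFn]
  · intro q hq
    funext l
    rw [← count_ofFn, hinv q hq, count_sortedList_succ]
  · intro k hk
    obtain ⟨hk, hmono⟩ := Finset.mem_filter.1 hk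
    have e : ∏ l ∈ Finset.Icc 1 n, (Finset.univ.filter fun i => k i = l).card ! =
        ∏ l : Fin n, (Finset.univ.filter fun i => k i = (l : ℕ) + 1).card ! := by
      rw [Fin.prod_univ_eq_prod_range
        (fun l => (Finset.univ.filter fun i => k i = l + 1).card !) n, Finset.range_eq_Ico,
        Finset.prod_Ico_add' (fun l => (Finset.univ.filter fun i => k i = l).card !) 0 n 1]
      rfl
    rw [sortedList_eq_ofFn hk hmono, weight, if_pos hmono, e]

/-! ### Graded pieces of the multinomial expansion -/

/-- The part of total degree `m` in the expansion of `(a 1 + ⋯ + a n) ^ p`, with `a l` of degree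
`l`. -/
def orderSum (n p m : ℕ) (a : ℕ → ℝ) : ℝ :=
  ∑ q ∈ mults n p m, (Nat.multinomial Finset.univ q : ℝ) * ∏ l : Fin n, a ((l : ℕ) + 1) ^ q l

theorem orderSum_nonneg {a : ℕ → ℝ} (ha : ∀ k, 0 ≤ a k) (n p m : ℕ) : 0 ≤ orderSum n p m a :=
  Finset.sum_nonneg fun _ _ => mul_nonneg (Nat.cast_nonneg _)
    (Finset.prod_nonneg fun _ _ => pow_nonneg (ha _) _)

theorem orderSum_mono {a b : ℕ → ℝ} (ha : ∀ k, 0 ≤ a k) (hab : ∀ k, a k ≤ b k) (n p m : ℕ) :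
    orderSum n p m a ≤ orderSum n p m b := by
  refine Finset.sum_le_sum fun q _ => mul_le_mul_of_nonneg_left ?_ (Nat.cast_nonneg _)
  exact Finset.prod_le_prod (fun _ _ => pow_nonneg (ha _) _) fun _ _ =>
    pow_le_pow_left₀ (ha _) (hab _) _

theorem orderSum_mul_pow (n p m : ℕ) (a : ℕ → ℝ) (x : ℝ) :
    orderSum n p m (fun k => a k * x ^ k) = orderSum n p m a * x ^ m := by
  rw [orderSum, orderSum, Finset.sum_mul]
  refine Finset.sum_congr rfl fun q hq => ?_
  rw [mul_assoc]
  congr 1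
  simp only [mul_pow, Finset.prod_mul_distrib, ← pow_mul]
  rw [Finset.prod_pow_eq_pow_sum, (mem_mults.1 hq).2]

/-- Distinct total degrees select disjoint families of nonnegative terms in the multinomial
expansion of the `p`-th power. -/
theorem sum_orderSum_le {a : ℕ → ℝ} (ha : ∀ k, 0 ≤ a k) (n p : ℕ) (M : Finset ℕ) :
    ∑ m ∈ M, orderSum n p m a ≤ (∑ l : Fin n, a ((l : ℕ) + 1)) ^ p := by
  classical
  rw [Finset.sum_pow_eq_sum_piAntidiag]
  have h : ∀ m, orderSum n p m a = ∑ q ∈ (Finset.univ : Finset (Fin n)).piAntidiag p,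
      if ∑ l : Fin n, ((l : ℕ) + 1) * q l = m then
        (Nat.multinomial Finset.univ q : ℝ) * ∏ l : Fin n, a ((l : ℕ) + 1) ^ q l else 0 := by
    intro m
    rw [orderSum, mults, Finset.sum_filter]
  simp only [h]
  rw [Finset.sum_comm]
  refine Finset.sum_le_sum fun q _ => ?_
  rw [Finset.sum_ite_eq]
  split_ifs
  · exact le_rfl
  · exact mul_nonneg (Nat.cast_nonneg _) (Finset.prod_nonneg fun _ _ => pow_nonneg (ha _) _)

theorem sum_orderSum_add_le {a : ℕ → ℝ} (ha : ∀ k, 0 ≤ a k) (n p : ℕ) (M : Finset ℕ) (d : ℕ) :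
    ∑ m ∈ M, orderSum n p (m + d) a ≤ (∑ l : Fin n, a ((l : ℕ) + 1)) ^ p := by
  have h := sum_orderSum_le ha n p (M.map (addRightEmbedding d))
  rwa [Finset.sum_map] at h

/-- The factorial produced by growing ranges in nested commutators is absorbed here by the weights.
-/
theorem one_div_prod_factorial {n : ℕ} (q : Fin n → ℕ) :
    (1 / ((∏ l, (q l)! : ℕ) : ℝ)) * (∑ l, q l)! = Nat.multinomial Finset.univ q := by
  have h := Nat.multinomial_spec Finset.univ q
  have h0 : ((∏ l, (q l)! : ℕ) : ℝ) ≠ 0 := by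
    exact_mod_cast (Finset.prod_pos fun l _ => Nat.factorial_pos _).ne'
  have h' : ((∏ l, (q l)! : ℕ) : ℝ) * Nat.multinomial Finset.univ q = (∑ l, q l)! := by
    exact_mod_cast h
  rw [← h']
  field_simp

/-! ### Nested commutators and the size of the generators -/

/-- Nested commutators with generators of ranges at most `n + 1`. -/
theorem Decomp.nested {U : Site} (hU : U.conjTranspose * U = 1) {n r : ℕ} (hr : r ≤ 1)
    {S : ℕ → TIOp} {s : ℕ → ℝ} {B : ℝ} {Q : TIOp} (hQ : Decomp U r B Q) :
    ∀ L : List ℕ, (∀ k ∈ L, 1 ≤ k ∧ k ≤ n ∧ Decomp U k (s k) (S k)) →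
      Decomp U (r + L.sum) (B * (L.length ! * (L.map fun k => 6 * n * s k).prod))
        ((L.map fun k => SpinChain.iad (S k)).prod Q) := by
  intro L
  induction L with
  | nil => intro _; simpa using hQ
  | cons k L ih =>
    intro hL
    obtain ⟨hk1, hkn, hk⟩ := hL k List.mem_cons_self
    have hL' : ∀ j ∈ L, 1 ≤ j ∧ j ≤ n ∧ Decomp U j (s j) (S j) := fun j hj =>
      hL j (List.mem_cons_of_mem _ hj)
    have hY := ih hL'
    have hstep := hk.iad hU hY
    have hsum : L.sum ≤ n * L.length := by
      clear ih hY hstep hL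
      induction L with
      | nil => simp
      | cons j L ih =>
        have := (hL' j List.mem_cons_self).2.1
        have := ih fun i hi => hL' i (List.mem_cons_of_mem _ hi)
        rw [List.sum_cons, List.length_cons, mul_add]
        omega
    have e : r + (k :: L).sum = r + L.sum + k := by
      rw [List.sum_cons]
      ring
    rw [e, List.map_cons, List.prod_cons, List.map_cons, List.prod_cons, List.length_cons,
      Nat.factorial_succ]
    refine Decomp.mono ?_ hstep
    have h0 := hY.nonneg
    have hs := hk.nonneg
    set P := B * (L.length ! * (L.map fun k => 6 * n * s k).prod) with hP
    -- From `r ≤ 1`, `L.sum ≤ n * L.length` and `1 ≤ k ≤ n`, the number of terms is at most `2n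
    -- (L.length + 1) + 4`. The factor `L.length + 1` builds the factorial.
    have hc : (2 * ((r + L.sum : ℕ) + k + 1) : ℝ) ≤ 6 * n * (L.length + 1 : ℕ) := by
      have : 2 * (r + L.sum + k + 1) ≤ 6 * n * (L.length + 1) := by nlinarith
      exact_mod_cast this
    calc 2 * (((r + L.sum : ℕ) : ℝ) + k + 1) * (s k * P)
        ≤ 6 * n * (L.length + 1 : ℕ) * (s k * P) :=
          mul_le_mul_of_nonneg_right hc (mul_nonneg hs h0)
      _ = _ := by
        rw [hP]
        push_cast
        ring

/-- The bound for nested commutators is insensitive to their order, so the permutation `f` covers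
both the reversed nesting in the potentials and the direct one in `quasiCoeff`; `c` carries the
sign. -/
theorem Decomp.sum_tuples {U : Site} (hU : U.conjTranspose * U = 1) {n r : ℕ} (hr : r ≤ 1)
    {S : ℕ → TIOp} {s : ℕ → ℝ} (hS : ∀ k, 1 ≤ k → Decomp U k (s k) (S k)) {B : ℝ} {Q : TIOp}
    (hQ : Decomp U r B Q) (p m : ℕ) {c : ℂ} (hc : ‖c‖ ≤ 1) (f : List ℕ → List ℕ)
    (hf : ∀ L, (f L).Perm L) :
    Decomp U (r + m) (B * orderSum n p m fun k => 6 * n * s k)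
      (∑ k ∈ tuples n p m, (c * weight n k) •
        (((f (List.ofFn k)).map fun i => SpinChain.iad (S i)).prod Q)) := by
  have h := sum_tuples_weight n p m
    fun L => c • (((f L).map fun i => SpinChain.iad (S i)).prod Q)
  simp only [smul_smul, mul_comm _ c] at h
  rw [h, orderSum, Finset.mul_sum]
  refine Decomp.sum _ fun q hq => ?_
  have hmem : ∀ k ∈ f (sortedList q), 1 ≤ k ∧ k ≤ n ∧ Decomp U k (s k) (S k) := fun k hk => by
    have := mem_sortedList q ((hf _).mem_iff.1 hk)
    exact ⟨this.1, this.2, hS k this.1⟩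
  have hY := hQ.nested hU hr (f (sortedList q)) hmem
  rw [(hf _).sum_eq, (hf _).length_eq, sum_sortedList, (mem_mults.1 hq).2, length_sortedList,
    ((hf _).map _).prod_eq, prod_map_sortedList] at hY
  refine Decomp.mono ?_ (hY.smul _)
  rw [norm_mul, ← one_div_prod_factorial]
  have h0 := hY.nonneg
  have e : ‖(1 / ((∏ l, (q l)! : ℕ) : ℂ))‖ = 1 / ((∏ l, (q l)! : ℕ) : ℝ) := by
    rw [norm_div, norm_one, Complex.norm_natCast]
  rw [e]
  calc ‖c‖ * (1 / ((∏ l, (q l)! : ℕ) : ℝ)) *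
        (B * (((∑ l, q l)! : ℕ) * ∏ l : Fin n, (6 * n * s ((l : ℕ) + 1)) ^ q l))
      ≤ 1 * (1 / ((∏ l, (q l)! : ℕ) : ℝ)) *
        (B * (((∑ l, q l)! : ℕ) * ∏ l : Fin n, (6 * n * s ((l : ℕ) + 1)) ^ q l)) := by
        gcongr
    _ = _ := by ring

/-- The bound on the generators of the Schrieffer–Wolff transformation. -/
def majorant (n m : ℕ) : ℝ :=
  1 / 2 * (∑ p ∈ Finset.Icc 2 m,
      orderSum n p m (fun k => 6 * n * if _h : k < m then majorant n k else 0) +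
    √30 * ∑ p ∈ Finset.range m,
      orderSum n p (m - 1) (fun k => 6 * n * if _h : k < m then majorant n k else 0))
termination_by m

theorem majorant_nonneg (n m : ℕ) : 0 ≤ majorant n m := by
  induction m using Nat.strong_induction_on with
  | _ m ih =>
    have h : ∀ k, 0 ≤ 6 * (n : ℝ) * if _h : k < m then majorant n k else 0 := by
      intro k
      split_ifs with hk
      · have := ih k hk
        positivity
      · simp
    rw [majorant]
    have h1 := Finset.sum_nonneg fun p (_ : p ∈ Finset.Icc 2 m) => orderSum_nonneg h n p m
    have h2 := Finset.sum_nonneg fun p (_ : p ∈ Finset.range m) => orderSum_nonneg h n p (m - 1)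
    positivity

/-- The generators are bounded by `majorant`. -/
theorem decomp_generator {U : Site} (hU : U.conjTranspose * U = 1) {n : ℕ} {Γ : ℝ} (hΓ : 0 < Γ)
    {H₀ T : TIOp} (hH : H₀ = (Γ : ℂ) • field U) (hr : H₀ ∈ rangeSpace 1) (hherm : IsHermitian H₀)
    (hT : Decomp U 1 (√30 * Γ) T) :
    ∀ m, 1 ≤ m → Decomp U m (majorant n m) (generator n H₀ T m) := by
  have hH0 : Decomp U 0 Γ H₀ := by
    have h := (decomp_field hU).smul (Γ : ℂ)
    rwa [Complex.norm_real, Real.norm_of_nonneg hΓ.le, mul_one, ← hH] at h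
  intro m
  induction m using Nat.strong_induction_on with
  | _ m ih =>
    intro hm
    set S : ℕ → TIOp := fun k => if _h : k < m then generator n H₀ T k else 0 with hS
    set s : ℕ → ℝ := fun k => if _h : k < m then majorant n k else 0 with hs
    have hSs : ∀ k, 1 ≤ k → Decomp U k (s k) (S k) := by
      intro k hk
      simp only [hS, hs]
      split_ifs with h
      · exact ih k h hk
      · exact Decomp.zero
    have hs0 : ∀ k, 0 ≤ 6 * (n : ℝ) * s k := by
      intro k
      simp only [hs]
      split_ifs
      · have := majorant_nonneg n k
        positivity
      · simp
    have hsum1 : ∀ p, Decomp U m (Γ * orderSum n p m fun k => 6 * n * s k)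
        (∑ k ∈ tuples n p m, weight n k •
          (List.ofFn fun i => iad (S (k i))).reverse.prod H₀) := by
      intro p
      have h := Decomp.sum_tuples hU zero_le_one hSs hH0 p m (n := n) (c := 1) (by simp)
        List.reverse fun L => L.reverse_perm
      simpa only [zero_add, one_mul, List.map_reverse, List.map_ofFn, Function.comp_def] using h
    have hsum2 : ∀ p, Decomp U m (√30 * Γ * orderSum n p (m - 1) fun k => 6 * n * s k)
        (∑ k ∈ tuples n p (m - 1), weight n k •
          (List.ofFn fun i => iad (S (k i))).reverse.prod T) := by
      intro p
      have h := Decomp.sum_tuples hU le_rfl hSs hT p (m - 1) (n := n) (c := 1) (by simp)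
        List.reverse fun L => L.reverse_perm
      have e : 1 + (m - 1) = m := by omega
      simpa only [e, one_mul, List.map_reverse, List.map_ofFn, Function.comp_def] using h
    -- `H₀` and `T` have sizes `Γ` and `√30 Γ`; the factor `2Γ` is cancelled by the spectral gap,
    -- which makes `majorant` independent of `Γ`.
    have hV : Decomp U m (2 * Γ * majorant n m) (potential n H₀ T S m) := by
      have e : 2 * Γ * majorant n m =
          ∑ p ∈ Finset.Icc 2 m, Γ * orderSum n p m (fun k => 6 * n * s k) +
          ∑ p ∈ Finset.range m, √30 * Γ * orderSum n p (m - 1) (fun k => 6 * n * s k) := by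
        rw [majorant, ← Finset.mul_sum, ← Finset.mul_sum]
        ring
      rw [e, potential]
      split_ifs with h1
      · subst h1
        refine Decomp.mono ?_ hT
        -- The `p = 0` term of the second sum in `majorant` accounts for the initial value `V_1 =
        -- T`.
        have h0 : orderSum n 0 0 (fun k => 6 * n * s k) = 1 := by
          have : mults n 0 0 = {0} := by
            ext q
            simp [mem_mults, funext_iff, Fin.forall_iff]
          rw [orderSum, this]
          simp [Nat.multinomial]
        simp [h0]
      · refine (Decomp.sum _ fun p _ => hsum1 p).add
          (Decomp.mono ?_ (Decomp.sum _ fun p _ => hsum2 p))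
        refine Finset.sum_le_sum_of_subset_of_nonneg ?_ fun p _ _ => ?_
        · intro p hp
          rw [Finset.mem_Icc] at hp
          rw [Finset.mem_range]
          omega
        · have := orderSum_nonneg hs0 n p (m - 1)
          positivity
    have h := (hV.pinv hU hΓ hH hr hherm).smul (-Complex.I)
    rw [norm_neg, Complex.norm_I, one_mul, mul_div_cancel_left₀ _ (by positivity)] at h
    rw [generator]
    exact h

/-! ### The generating polynomial and the radius -/

/-- The generating polynomial of the majorants of order less than `N`. -/
def majorantSum (n N : ℕ) (x : ℝ) : ℝ :=
  ∑ l : Fin n, 6 * n * (if (l : ℕ) + 1 < N then majorant n ((l : ℕ) + 1) else 0) * x ^ ((l : ℕ) + 1)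

theorem sum_pow_le_div {A : ℝ} (hA : 0 ≤ A) (hA1 : A < 1) (d : ℕ) (F : Finset ℕ)
    (hF : ∀ p ∈ F, d ≤ p) : ∑ p ∈ F, A ^ p ≤ A ^ d / (1 - A) := by
  have hs : Summable fun p : ℕ => A ^ d * A ^ p :=
    (summable_geometric_of_lt_one hA hA1).mul_left _
  have h2 : ∑ p ∈ F, A ^ p = ∑ p ∈ F.image (fun p => p - d), A ^ d * A ^ p := by
    rw [Finset.sum_image]
    · refine Finset.sum_congr rfl fun p hp => ?_
      rw [← pow_add, Nat.add_sub_cancel' (hF p hp)]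
    · intro a ha b hb hab
      have := hF a ha
      have := hF b hb
      simp only at hab
      omega
  rw [h2]
  refine (hs.sum_le_tsum _ fun p _ => by positivity).trans_eq ?_
  rw [tsum_mul_left, tsum_geometric_of_lt_one hA hA1, div_eq_mul_inv]

/-- The recursion for order `m + 1` involves only lower orders, so for `m < N` it can be bounded
with the coefficients already collected in `A`. Summing over orders leaves powers of `A`: those from
`H₀` start at `p = 2`, those from `T` at `p = 0` with one extra `x`. The factor `3n` is `6n` times
the `1/2` in `majorant`. -/
theorem majorantSum_succ_le {n N : ℕ} {x : ℝ} (hx : 0 ≤ x) (hA1 : majorantSum n N x < 1) :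
    majorantSum n (N + 1) x ≤
      3 * n * ((majorantSum n N x ^ 2 + √30 * x) / (1 - majorantSum n N x)) := by
  set A := majorantSum n N x with hA
  set a : ℕ → ℝ := fun k => 6 * n * (if k < N then majorant n k else 0) * x ^ k with ha
  have ha0 : ∀ k, 0 ≤ a k := by
    intro k
    have := majorant_nonneg n k
    simp only [ha]
    split_ifs <;> positivity
  have hAa : ∑ l : Fin n, a ((l : ℕ) + 1) = A := rfl
  have hA0 : 0 ≤ A := Finset.sum_nonneg fun l _ => ha0 _
  have hmaj : ∀ m, m < N → 6 * n * majorant n (m + 1) * x ^ (m + 1) ≤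
      3 * n * (∑ p ∈ Finset.Icc 2 N, orderSum n p (m + 1) a +
        √30 * x * ∑ p ∈ Finset.range N, orderSum n p m a) := by
    intro m hm
    set b : ℕ → ℝ := fun k => 6 * n * if _h : k < m + 1 then majorant n k else 0 with hb
    have hb0 : ∀ k, 0 ≤ b k := by
      intro k
      have := majorant_nonneg n k
      simp only [hb]
      split_ifs <;> positivity
    have hba : ∀ k, b k * x ^ k ≤ a k := by
      intro k
      have := majorant_nonneg n k
      simp only [hb, ha]
      refine mul_le_mul_of_nonneg_right ?_ (by positivity)
      refine mul_le_mul_of_nonneg_left ?_ (by positivity)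
      split_ifs
      · exact le_rfl
      · omega
      · exact this
      · exact le_rfl
    have horder : ∀ p j, orderSum n p j b * x ^ j ≤ orderSum n p j a := by
      intro p j
      rw [← orderSum_mul_pow]
      exact orderSum_mono (fun k => mul_nonneg (hb0 k) (pow_nonneg hx k)) hba n p j
    have h1 : (∑ p ∈ Finset.Icc 2 (m + 1), orderSum n p (m + 1) b) * x ^ (m + 1) ≤
        ∑ p ∈ Finset.Icc 2 N, orderSum n p (m + 1) a := by
      rw [Finset.sum_mul]
      refine (Finset.sum_le_sum fun p _ => horder p (m + 1)).trans ?_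
      exact Finset.sum_le_sum_of_subset_of_nonneg (Finset.Icc_subset_Icc le_rfl (by omega))
        fun p _ _ => orderSum_nonneg ha0 _ _ _
    have h2 : (∑ p ∈ Finset.range (m + 1), orderSum n p m b) * x ^ m ≤
        ∑ p ∈ Finset.range N, orderSum n p m a := by
      rw [Finset.sum_mul]
      refine (Finset.sum_le_sum fun p _ => horder p m).trans ?_
      exact Finset.sum_le_sum_of_subset_of_nonneg (Finset.range_subset_range.2 (by omega))
        fun p _ _ => orderSum_nonneg ha0 _ _ _
    rw [majorant, Nat.add_sub_cancel]
    calc _ = 3 * n * ((∑ p ∈ Finset.Icc 2 (m + 1), orderSum n p (m + 1) b) * x ^ (m + 1) +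
          √30 * x * ((∑ p ∈ Finset.range (m + 1), orderSum n p m b) * x ^ m)) := by
          rw [pow_succ]
          ring
      _ ≤ _ := by gcongr
  have hsum : majorantSum n (N + 1) x ≤
      ∑ m ∈ Finset.range N, 6 * n * majorant n (m + 1) * x ^ (m + 1) := by
    have e : majorantSum n (N + 1) x = ∑ m ∈ (Finset.range n).filter fun m => m + 1 < N + 1,
        6 * n * majorant n (m + 1) * x ^ (m + 1) := by
      rw [majorantSum, Fin.sum_univ_eq_sum_range
        (fun m => 6 * n * (if m + 1 < N + 1 then majorant n (m + 1) else 0) * x ^ (m + 1)) n,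
        Finset.sum_filter]
      refine Finset.sum_congr rfl fun m _ => ?_
      split_ifs <;> simp
    rw [e]
    refine Finset.sum_le_sum_of_subset_of_nonneg ?_ fun m _ _ => ?_
    · intro m hm
      have := (Finset.mem_filter.1 hm).2
      rw [Finset.mem_range]
      omega
    · have := majorant_nonneg n (m + 1)
      positivity
  have h1 : ∑ m ∈ Finset.range N, ∑ p ∈ Finset.Icc 2 N, orderSum n p (m + 1) a ≤
      A ^ 2 / (1 - A) := by
    rw [Finset.sum_comm]
    refine (Finset.sum_le_sum fun p _ => sum_orderSum_add_le ha0 n p _ 1).trans ?_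
    rw [hAa]
    exact sum_pow_le_div hA0 hA1 2 _ fun p hp => (Finset.mem_Icc.1 hp).1
  have h2 : ∑ m ∈ Finset.range N, ∑ p ∈ Finset.range N, orderSum n p m a ≤ 1 / (1 - A) := by
    rw [Finset.sum_comm]
    refine (Finset.sum_le_sum fun p _ => sum_orderSum_le ha0 n p _).trans ?_
    rw [hAa]
    simpa using sum_pow_le_div hA0 hA1 0 (Finset.range N) fun p _ => Nat.zero_le p
  calc majorantSum n (N + 1) x
      ≤ ∑ m ∈ Finset.range N, 3 * n * (∑ p ∈ Finset.Icc 2 N, orderSum n p (m + 1) a +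
        √30 * x * ∑ p ∈ Finset.range N, orderSum n p m a) :=
        hsum.trans (Finset.sum_le_sum fun m hm => hmaj m (Finset.mem_range.1 hm))
    _ = 3 * n * (∑ m ∈ Finset.range N, ∑ p ∈ Finset.Icc 2 N, orderSum n p (m + 1) a +
        √30 * x * ∑ m ∈ Finset.range N, ∑ p ∈ Finset.range N, orderSum n p m a) := by
        rw [← Finset.mul_sum, Finset.sum_add_distrib, ← Finset.mul_sum]
    _ ≤ 3 * n * (A ^ 2 / (1 - A) + √30 * x * (1 / (1 - A))) := by gcongr
    _ = _ := by ring

theorem majorantSum_nonneg {n N : ℕ} {x : ℝ} (hx : 0 ≤ x) : 0 ≤ majorantSum n N x := by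
  refine Finset.sum_nonneg fun l _ => ?_
  have := majorant_nonneg n ((l : ℕ) + 1)
  split_ifs <;> positivity

theorem rho_pos {n : ℕ} (hn : 1 ≤ n) : 0 < rho n := by
  have : (0 : ℝ) < n := by exact_mod_cast hn
  rw [rho]
  positivity

/-- The constant 263 originates here: `6n (6n + 2) ≤ 48 n²` for `n ≥ 1`, and `48 √30 ≤ 263`. -/
theorem sqrt_mul_rho_le {n : ℕ} (hn : 1 ≤ n) : √30 * rho n ≤ 1 / (6 * n * (6 * n + 2)) := by
  have hn' : (1 : ℝ) ≤ n := by exact_mod_cast hn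
  have hs : √30 ≤ 263 / 48 := by
    rw [Real.sqrt_le_left (by norm_num)]
    norm_num
  rw [rho, mul_one_div, div_le_div_iff₀ (by positivity) (by positivity), one_mul]
  calc √30 * (6 * n * (6 * n + 2)) ≤ 263 / 48 * (6 * n * (6 * n + 2)) := by gcongr
    _ ≤ 263 * (n : ℝ) ^ 2 := by nlinarith

/-- The generating polynomial of the majorants stays small up to the radius `rho n`. -/
theorem majorantSum_rho_le {n : ℕ} (hn : 1 ≤ n) (N : ℕ) :
    majorantSum n N (rho n) ≤ 1 / (6 * n + 2) := by
  have hn' : (1 : ℝ) ≤ n := by exact_mod_cast hn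
  induction N with
  | zero =>
    simp only [majorantSum, not_lt_zero, if_false, mul_zero, zero_mul, Finset.sum_const_zero]
    positivity
  | succ N ih =>
    have hA0 := majorantSum_nonneg (n := n) (N := N) (rho_pos hn).le
    have hlt : 1 / (6 * n + 2 : ℝ) < 1 := by
      rw [div_lt_one (by positivity)]
      linarith
    refine (majorantSum_succ_le (rho_pos hn).le (ih.trans_lt hlt)).trans ?_
    have hy := sqrt_mul_rho_le hn
    set A := majorantSum n N (rho n)
    -- After the bounds on `A` and `√30 * rho n` are inserted, `1 / (6n + 2)` is an exact fixed
    -- point of the recursion, so the induction closes.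
    calc 3 * (n : ℝ) * ((A ^ 2 + √30 * rho n) / (1 - A))
        ≤ 3 * (n : ℝ) * (((1 / (6 * n + 2)) ^ 2 + 1 / (6 * n * (6 * n + 2))) /
          (1 - 1 / (6 * (n : ℝ) + 2))) := by
          have : 0 < 1 - 1 / (6 * n + 2 : ℝ) := by linarith
          gcongr
      _ = 1 / (6 * (n : ℝ) + 2) := by
          have h1 : (6 * n + 1 : ℝ) ≠ 0 := by linarith
          have h2 : (6 * n + 2 : ℝ) ≠ 0 := by linarith
          have h3 : (n : ℝ) ≠ 0 := by linarith
          have h4 : 1 - 1 / (6 * n + 2 : ℝ) = (6 * n + 1) / (6 * n + 2) := by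
            field_simp
            ring
          rw [h4]
          field_simp
          ring

theorem majorantSum_eq (n : ℕ) (x : ℝ) :
    majorantSum n (n + 1) x =
      ∑ l : Fin n, 6 * n * majorant n ((l : ℕ) + 1) * x ^ ((l : ℕ) + 1) := by
  refine Finset.sum_congr rfl fun l _ => ?_
  rw [if_pos (by omega)]

theorem majorantSum_rho_le_one_eighth {n : ℕ} (hn : 1 ≤ n) (N : ℕ) :
    majorantSum n N (rho n) ≤ 1 / 8 := by
  have hn' : (1 : ℝ) ≤ n := by exact_mod_cast hn
  refine (majorantSum_rho_le hn N).trans ?_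
  rw [div_le_div_iff₀ (by positivity) (by norm_num)]
  linarith

theorem majorantSum_mono {n N : ℕ} {x y : ℝ} (hx : 0 ≤ x) (hxy : x ≤ y) :
    majorantSum n N x ≤ majorantSum n N y := by
  refine Finset.sum_le_sum fun l _ => ?_
  have := majorant_nonneg n ((l : ℕ) + 1)
  split_ifs <;> gcongr

/-! ### Bounds on the coefficients of the expansion -/

theorem decomp_quasiCoeff {U : Site} (hU : U.conjTranspose * U = 1) {n : ℕ} {Γ : ℝ} {H₀ T : TIOp}
    (hH : Decomp U 0 Γ H₀)
    (hS : ∀ m, 1 ≤ m → Decomp U m (majorant n m) (generator n H₀ T m)) (m : ℕ) :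
    Decomp U m (∑ p ∈ Finset.Icc 1 m, Γ * orderSum n p m fun k => 6 * n * majorant n k)
      (quasiCoeff n H₀ T m) := by
  refine Decomp.sum _ fun p _ => ?_
  have h := Decomp.sum_tuples hU zero_le_one hS hH p m (n := n) (c := (-1) ^ p) (by simp)
    id fun L => List.Perm.refl L
  simpa only [zero_add, id, List.map_ofFn, Function.comp_def] using h

/-- Absorbing `rho n ^ m` into the variables bounds the term of length `p` by `A ^ p`; the sum over
`p ≥ 1` is at most `A / (1 - A)`, and `A ≤ 1/8`. -/
theorem sum_orderSum_rho_le_one {n : ℕ} (hn : 1 ≤ n) (m : ℕ) :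
    (∑ p ∈ Finset.Icc 1 m, orderSum n p m fun k => 6 * n * majorant n k) * rho n ^ m ≤ 1 := by
  have hA := majorantSum_rho_le_one_eighth hn (n + 1)
  have hA0 := majorantSum_nonneg (n := n) (N := n + 1) (rho_pos hn).le
  have h0 : ∀ k, 0 ≤ 6 * (n : ℝ) * majorant n k * rho n ^ k := fun k => by
    have := majorant_nonneg n k
    have := (rho_pos hn).le
    positivity
  rw [Finset.sum_mul]
  calc ∑ p ∈ Finset.Icc 1 m, (orderSum n p m fun k => 6 * n * majorant n k) * rho n ^ m
      ≤ ∑ p ∈ Finset.Icc 1 m, majorantSum n (n + 1) (rho n) ^ p := by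
        refine Finset.sum_le_sum fun p _ => ?_
        rw [← orderSum_mul_pow, majorantSum_eq]
        simpa using sum_orderSum_le h0 n p {m}
    _ ≤ majorantSum n (n + 1) (rho n) ^ 1 / (1 - majorantSum n (n + 1) (rho n)) :=
        sum_pow_le_div hA0 (by linarith) 1 _ fun p hp => (Finset.mem_Icc.1 hp).1
    _ ≤ 1 := by
        rw [pow_one, div_le_one (by linarith)]
        linarith

/-! ### The product of exponential series -/

theorem list_prod_smul {R A : Type*} [CommSemiring R] [Semiring A] [Algebra R A] {n : ℕ}
    (c : Fin n → R) (a : Fin n → A) :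
    (List.ofFn fun l => c l • a l).prod = (∏ l, c l) • (List.ofFn a).prod := by
  induction n with
  | zero => simp
  | succ n ih =>
    rw [List.ofFn_succ, List.prod_cons, ih, List.ofFn_succ, List.prod_cons, Fin.prod_univ_succ,
      smul_mul_smul_comm]

/-- The exponents of the exponential series are exactly the multiplicities of an increasing tuple,
which links the conjugation with the sums defining `quasiCoeff`. -/
theorem conjTerm_eq (n : ℕ) (S : ℕ → TIOp) (ε : ℝ) (X : TIOp) (q : Fin n → ℕ) :
    conjTerm n S ε X q =
      ((-1 : ℂ) ^ (∑ l, q l) * (ε : ℂ) ^ (∑ l : Fin n, ((l : ℕ) + 1) * q l) *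
        (1 / ((∏ l, (q l)! : ℕ) : ℂ))) •
        ((sortedList q).map fun k => iad (S k)).prod X := by
  have e : ((sortedList q).map fun k => iad (S k)).prod =
      (List.ofFn fun l : Fin n => iad (S ((l : ℕ) + 1)) ^ q l).prod := by
    rw [sortedList, List.map_flatten, List.prod_flatten, List.map_ofFn, List.map_ofFn]
    simp [Function.comp_def]
  rw [conjTerm, e]
  simp only [smul_pow, smul_smul]
  rw [list_prod_smul, LinearMap.smul_apply]
  congr 1
  simp only [neg_pow ((ε : ℂ) ^ _), ← pow_mul, Finset.prod_mul_distrib, Finset.prod_pow_eq_pow_sum,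
    Finset.prod_div_distrib, Finset.prod_const_one]
  push_cast
  ring

theorem frobNorm_conjTerm_le {U : Site} (hU : U.conjTranspose * U = 1) {n : ℕ} {Γ : ℝ}
    {S : ℕ → TIOp} {s : ℕ → ℝ} {X : TIOp} (hX : Decomp U 0 Γ X) (hS : ∀ m, 1 ≤ m → Decomp U m (s m) (S m))
    (ε : ℝ) (q : Fin n → ℕ) :
    frobNorm (conjTerm n S ε X q) ≤ Γ * ((Nat.multinomial Finset.univ q : ℝ) *
      ∏ l : Fin n, (6 * n * s ((l : ℕ) + 1) * |ε| ^ ((l : ℕ) + 1)) ^ q l) := by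
  have h := hX.nested hU zero_le_one (n := n) (s := s) (S := S) (sortedList q) fun k hk => by
    have := mem_sortedList q hk
    exact ⟨this.1, this.2, hS k this.1⟩
  have h2 := h.frobNorm_le hU
  rw [length_sortedList, prod_map_sortedList] at h2
  rw [conjTerm_eq, frobNorm_smul]
  refine (mul_le_mul_of_nonneg_left h2 (norm_nonneg _)).trans_eq ?_
  rw [← one_div_prod_factorial]
  simp only [norm_mul, norm_pow, norm_neg, norm_one, one_pow, norm_div, Complex.norm_real,
    Complex.norm_natCast, Real.norm_eq_abs, mul_pow, Finset.prod_mul_distrib, ← pow_mul,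
    Finset.prod_pow_eq_pow_sum]
  ring

/-- The product of exponential series converges absolutely. -/
theorem summable_frobNorm_conjTerm {U : Site} (hU : U.conjTranspose * U = 1) {n : ℕ} (hn : 1 ≤ n)
    {Γ : ℝ} {S : ℕ → TIOp} {X : TIOp} (hX : Decomp U 0 Γ X)
    (hS : ∀ m, 1 ≤ m → Decomp U m (majorant n m) (S m)) {ε : ℝ} (hε : |ε| ≤ rho n) :
    Summable fun q : Fin n → ℕ => frobNorm (conjTerm n S ε X q) := by
  classical
  set A := majorantSum n (n + 1) |ε| with hA
  have hA0 : 0 ≤ A := majorantSum_nonneg (abs_nonneg _)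
  have hA1 : A ≤ 1 / 8 :=
    (majorantSum_mono (abs_nonneg _) hε).trans (majorantSum_rho_le_one_eighth hn _)
  set f : (Fin n → ℕ) → ℝ := fun q => (Nat.multinomial Finset.univ q : ℝ) *
      ∏ l : Fin n, (6 * n * majorant n ((l : ℕ) + 1) * |ε| ^ ((l : ℕ) + 1)) ^ q l with hf
  have hf0 : ∀ q, 0 ≤ f q := fun q => mul_nonneg (Nat.cast_nonneg _) <|
    Finset.prod_nonneg fun l _ => by
      have := majorant_nonneg n ((l : ℕ) + 1)
      positivity
  have hsum : Summable f := by
    -- A finite set of exponents is enlarged to full layers of fixed total exponent `p`; each layer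
    -- sums to `A ^ p` by the multinomial theorem.
    refine summable_of_sum_le (c := 1 / (1 - A)) hf0 fun F => ?_
    have hdeg : ∀ p, ∑ q ∈ (Finset.univ : Finset (Fin n)).piAntidiag p, f q = A ^ p := by
      intro p
      rw [hA, majorantSum_eq, Finset.sum_pow_eq_sum_piAntidiag]
    calc ∑ q ∈ F, f q
        ≤ ∑ q ∈ (F.image fun q => ∑ l, q l).biUnion
            fun p => (Finset.univ : Finset (Fin n)).piAntidiag p, f q := by
          refine Finset.sum_le_sum_of_subset_of_nonneg (fun q hq => ?_) fun q _ _ => hf0 q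
          rw [Finset.mem_biUnion]
          exact ⟨_, Finset.mem_image_of_mem _ hq, by simp⟩
      _ = ∑ p ∈ F.image fun q => ∑ l, q l, A ^ p := by
          rw [Finset.sum_biUnion]
          · exact Finset.sum_congr rfl fun p _ => hdeg p
          · intro p _ p' _ hne
            rw [Function.onFun, Finset.disjoint_left]
            intro q hq hq'
            rw [Finset.mem_piAntidiag] at hq hq'
            exact hne (hq.1.symm.trans hq'.1)
      _ ≤ A ^ 0 / (1 - A) := sum_pow_le_div hA0 (by linarith) 0 _ fun p _ => Nat.zero_le p
      _ = 1 / (1 - A) := by rw [pow_zero]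
  exact (hsum.mul_left Γ).of_nonneg_of_le (fun q => frobNorm_nonneg _)
    fun q => frobNorm_conjTerm_le hU hX hS ε q

/-! ### Regrouping by powers of `ε` -/

/-- The multiplicity vectors of total degree `m`. -/
def degreeFiber (n m : ℕ) : Finset (Fin n → ℕ) :=
  open Classical in (Finset.range (m + 1)).biUnion fun p => mults n p m

theorem mem_degreeFiber {n m : ℕ} {q : Fin n → ℕ} :
    q ∈ degreeFiber n m ↔ ∑ l : Fin n, ((l : ℕ) + 1) * q l = m := by
  classical
  simp only [degreeFiber, Finset.mem_biUnion, Finset.mem_range, mem_mults]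
  constructor
  · rintro ⟨p, _, _, h⟩
    exact h
  · intro h
    refine ⟨_, ?_, rfl, h⟩
    rw [← h, Nat.lt_succ_iff]
    refine Finset.sum_le_sum fun l _ => ?_
    nlinarith

theorem sum_degreeFiber {X : Type*} [AddCommMonoid X] (n m : ℕ) (f : (Fin n → ℕ) → X) :
    ∑ q ∈ degreeFiber n m, f q = ∑ p ∈ Finset.range (m + 1), ∑ q ∈ mults n p m, f q := by
  classical
  rw [degreeFiber, Finset.sum_biUnion]
  intro p _ p' _ hne
  rw [Function.onFun, Finset.disjoint_left]
  intro q hq hq'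
  exact hne ((mem_mults.1 hq).1.symm.trans (mem_mults.1 hq').1)

/-- The part of order `m` in `ε` of the product of exponential series. -/
theorem sum_conjTerm_degreeFiber (n : ℕ) (H₀ T : TIOp) (ε : ℝ) (m : ℕ) :
    ∑ q ∈ degreeFiber n m, conjTerm n (generator n H₀ T) ε H₀ q =
      if m = 0 then H₀ else (ε : ℂ) ^ m • quasiCoeff n H₀ T m := by
  split_ifs with h0
  · subst h0
    have e : degreeFiber n 0 = {0} := by
      ext q
      rw [mem_degreeFiber, Finset.mem_singleton]
      simp [funext_iff]
    rw [e, Finset.sum_singleton, conjTerm_eq]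
    simp [sortedList]
  -- The empty tuple has degree 0, so for `m ≠ 0` the sum over lengths starts at `p = 1` as in
  -- `quasiCoeff`.
  · have h1 : mults n 0 m = ∅ := by
      rw [Finset.eq_empty_iff_forall_notMem]
      intro q hq
      obtain ⟨hq0, hqm⟩ := mem_mults.1 hq
      have hz : ∀ l, q l = 0 := by simpa using hq0
      simp only [hz, mul_zero, Finset.sum_const_zero] at hqm
      exact h0 hqm.symm
    rw [sum_degreeFiber, Finset.sum_range_eq_add_Ico _ (by omega), h1, Finset.sum_empty, zero_add,
      quasiCoeff, Finset.smul_sum]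
    refine Finset.sum_congr rfl fun p _ => ?_
    have h := sum_tuples_weight n p m fun L =>
      (((-1 : ℂ) ^ p * (ε : ℂ) ^ m) • (L.map fun k => iad (generator n H₀ T k)).prod H₀)
    simp only [List.map_ofFn, Function.comp_def, smul_smul] at h
    rw [Finset.smul_sum]
    calc _ = ∑ q ∈ mults n p m, (1 / ((∏ l, (q l)! : ℕ) : ℂ) * ((-1 : ℂ) ^ p * (ε : ℂ) ^ m)) •
          ((sortedList q).map fun k => iad (generator n H₀ T k)).prod H₀ := by
          refine Finset.sum_congr rfl fun q hq => ?_
          rw [conjTerm_eq, (mem_mults.1 hq).1, (mem_mults.1 hq).2, mul_comm]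
      _ = _ := by
          rw [← h]
          refine Finset.sum_congr rfl fun k _ => ?_
          rw [smul_smul]
          congr 1
          ring

/-- An unconditionally convergent sum may be partitioned along the total degree, whose fibers are
finite. -/
theorem hasSum_sum_degreeFiber {X : Type*} [AddCommGroup X] [TopologicalSpace X]
    [IsTopologicalAddGroup X] [RegularSpace X] {n : ℕ} {f : (Fin n → ℕ) → X} {x : X}
    (h : HasSum f x) : HasSum (fun m => ∑ q ∈ degreeFiber n m, f q) x := by
  have h1 := (Equiv.sigmaFiberEquiv
    fun q : Fin n → ℕ => ∑ l : Fin n, ((l : ℕ) + 1) * q l).hasSum_iff.2 h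
  refine h1.sigma fun m => ?_
  have h2 : HasSum (fun q : {q // q ∈ degreeFiber n m} => f q) (∑ q ∈ degreeFiber n m, f q) :=
    (degreeFiber n m).hasSum f
  have e : ∀ q : Fin n → ℕ, ∑ l : Fin n, ((l : ℕ) + 1) * q l = m ↔ q ∈ degreeFiber n m :=
    fun q => mem_degreeFiber.symm
  exact (Equiv.subtypeEquivRight e).hasSum_iff.2 h2

theorem hasSum_conjTerm_degree {n : ℕ} {H₀ T : TIOp} {ε : ℝ}
    (h : Summable fun q : Fin n → ℕ => frobNorm (conjTerm n (generator n H₀ T) ε H₀ q)) :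
    HasSum (fun m : ℕ => toHilbert (if m = 0 then H₀ else (ε : ℂ) ^ m • quasiCoeff n H₀ T m))
      (quasiConserved n H₀ T ε) := by
  have h1 : HasSum (fun q => toHilbert (conjTerm n (generator n H₀ T) ε H₀ q))
      (quasiConserved n H₀ T ε) := (Summable.of_norm h).hasSum
  have h2 := hasSum_sum_degreeFiber h1
  simp only [← map_sum, sum_conjTerm_degreeFiber] at h2
  exact h2

/-! ### Assembly of the estimates -/

theorem rangeSpace_mono {M M' : ℕ} (h : M ≤ M') : rangeSpace M ≤ rangeSpace M' := by
  refine Finsupp.supported_mono fun a ha j hj => ha j ?_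
  have : (M : ℤ) ≤ M' := by exact_mod_cast h
  omega

theorem quasiCoeff_zero_left (n : ℕ) (T : TIOp) (m : ℕ) : quasiCoeff n 0 T m = 0 := by
  simp [quasiCoeff]

theorem quasiCoeff_bound_and_summable {n : ℕ} (hn : 1 ≤ n) {Γ : ℝ} {H₀ T : TIOp}
    (hH₀ : H₀ ∈ rangeSpace 1) (hT : T ∈ rangeSpace 2) (hH₀_herm : IsHermitian H₀)
    (hH₀_norm : frobNorm H₀ = Γ) (hT_norm : frobNorm T = Γ) :
    (∀ m, quasiCoeff n H₀ T m ∈ rangeSpace (m + 1) ∧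
      frobNorm (quasiCoeff n H₀ T m) ≤ Γ * (rho n ^ m)⁻¹) ∧
    ∀ ε : ℝ, |ε| ≤ rho n →
      Summable fun q : Fin n → ℕ => frobNorm (conjTerm n (generator n H₀ T) ε H₀ q) := by
  have hΓ : 0 ≤ Γ := hH₀_norm ▸ frobNorm_nonneg H₀
  -- For `Γ = 0` there is no field axis and no gap, but then `H₀ = 0` and everything it generates
  -- vanishes.
  rcases hΓ.eq_or_lt with hΓ0 | hΓ0
  · have h0 : H₀ = 0 := eq_zero_of_frobNorm_eq_zero (hH₀_norm.trans hΓ0.symm)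
    subst h0
    refine ⟨fun m => ?_, fun ε _ => ?_⟩
    · rw [quasiCoeff_zero_left, frobNorm_zero, ← hΓ0, zero_mul]
      exact ⟨Submodule.zero_mem _, le_rfl⟩
    · simp [conjTerm, frobNorm_zero, summable_zero]
  · obtain ⟨U, hU, hHU⟩ := exists_eq_smul_field hH₀ hH₀_herm (hH₀_norm ▸ hΓ0)
    rw [hH₀_norm] at hHU
    have hH : Decomp U 0 Γ H₀ := by
      have h := (decomp_field hU).smul (Γ : ℂ)
      rwa [Complex.norm_real, Real.norm_of_nonneg hΓ, mul_one, ← hHU] at h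
    have hS := decomp_generator (n := n) hU hΓ0 hHU hH₀ hH₀_herm
      (hT_norm ▸ decomp_of_mem_rangeSpace_two hU hT)
    refine ⟨fun m => ?_, fun ε hε => summable_frobNorm_conjTerm hU hn hH hS hε⟩
    have hq := decomp_quasiCoeff hU hH hS m
    refine ⟨hq.mem_rangeSpace, (hq.frobNorm_le hU).trans ?_⟩
    rw [← Finset.mul_sum]
    refine mul_le_mul_of_nonneg_left ?_ hΓ
    rw [← one_div, le_div_iff₀ (pow_pos (rho_pos hn) m)]
    exact sum_orderSum_rho_le_one hn m

end SpinChain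

end

open SpinChain in
theorem mainTheorem3 (n : ℕ) (hn : 1 ≤ n) (Γ : ℝ) (H₀ T : TIOp)
    (hH₀ : H₀ ∈ rangeSpace 1) (hT : T ∈ rangeSpace 2)
    (hH₀_herm : IsHermitian H₀) (hT_herm : IsHermitian T)
    (hH₀_norm : frobNorm H₀ = Γ) (hT_norm : frobNorm T = Γ) :
    (∀ m : ℕ, 1 ≤ m →
      quasiCoeff n H₀ T m ∈ rangeSpace (m + 1) ∧
      frobNorm (quasiCoeff n H₀ T m) ≤ Γ * (rho n ^ m)⁻¹) ∧
    ∀ ε : ℝ, |ε| / rho n ≤ 1 / 2 →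
      Summable (fun p : Fin n → ℕ =>
        frobNorm (conjTerm n (generator n H₀ T) ε H₀ p)) ∧
      Summable (fun m : ℕ => frobNorm (quasiCoeff n H₀ T m) * |ε| ^ m) ∧
      HasSum (fun m : ℕ => ((ε : ℂ) ^ (m + 1)) • toHilbert (quasiCoeff n H₀ T (m + 1)))
        (quasiConserved n H₀ T ε - toHilbert H₀) ∧
      quasiConserved n H₀ T ε =
        toHilbert (H₀ + ∑ m ∈ Finset.Icc 1 n, ((ε : ℂ) ^ m) • quasiCoeff n H₀ T m) +
          remainder n H₀ T ε ∧
      ‖remainder n H₀ T ε‖ ≤ 2 * Γ * (|ε| / rho n) ^ (n + 1) ∧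
      quasiConserved n H₀ T ε ∈ closure localOps := by
  obtain ⟨hcoeff, hconj⟩ :=
    quasiCoeff_bound_and_summable hn hH₀ hT hH₀_herm hH₀_norm hT_norm
  refine ⟨fun m _ => hcoeff m, fun ε hε => ?_⟩
  have hΓ : 0 ≤ Γ := hH₀_norm ▸ frobNorm_nonneg H₀
  have hρ := rho_pos hn
  set θ := |ε| / rho n with hθ
  have hθ0 : 0 ≤ θ := by positivity
  have hθ1 : θ < 1 := by linarith
  have hερ : |ε| ≤ rho n := by
    rw [hθ, div_le_iff₀ hρ] at hε
    linarith
  -- The radius enters only through `θ`; this geometric bound yields both absolute convergence and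
  -- the tail estimate.
  have hbound : ∀ m, frobNorm (quasiCoeff n H₀ T m) * |ε| ^ m ≤ Γ * θ ^ m := by
    intro m
    calc frobNorm (quasiCoeff n H₀ T m) * |ε| ^ m ≤ Γ * (rho n ^ m)⁻¹ * |ε| ^ m := by
          gcongr
          exact (hcoeff m).2
      _ = Γ * θ ^ m := by
          rw [hθ, div_pow]
          ring
  have hgeom := summable_geometric_of_lt_one hθ0 hθ1
  set G : ℕ → TIOp := fun m => if m = 0 then H₀ else (ε : ℂ) ^ m • quasiCoeff n H₀ T m with hG
  have hsum : HasSum (fun m => toHilbert (G m)) (quasiConserved n H₀ T ε) :=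
    hasSum_conjTerm_degree (hconj ε hερ)
  have hG0 : G 0 = H₀ := if_pos rfl
  have hGs : ∀ m, m ≠ 0 → G m = (ε : ℂ) ^ m • quasiCoeff n H₀ T m := fun m hm => if_neg hm
  have hpart : ∀ N, ∑ m ∈ Finset.range (N + 1), G m =
      H₀ + ∑ m ∈ Finset.Icc 1 N, ((ε : ℂ) ^ m) • quasiCoeff n H₀ T m := by
    intro N
    rw [Finset.sum_range_eq_add_Ico _ (by omega), hG0]
    congr 1
    refine Finset.sum_congr rfl fun m hm => hGs m ?_
    have := (Finset.mem_Ico.1 hm).1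
    omega
  have hGmem : ∀ m, G m ∈ rangeSpace (m + 1) := by
    intro m
    rcases eq_or_ne m 0 with rfl | hm
    · rw [hG0]
      exact hH₀
    · rw [hGs m hm]
      exact Submodule.smul_mem _ _ (hcoeff m).1
  have hrem : HasSum
      (fun m : ℕ => ((ε : ℂ) ^ (n + 1 + m)) • toHilbert (quasiCoeff n H₀ T (n + 1 + m)))
      (quasiConserved n H₀ T ε - ∑ m ∈ Finset.range (n + 1), toHilbert (G m)) := by
    have h := (hasSum_nat_add_iff' (n + 1)).2 hsum
    refine h.congr_fun fun m => ?_
    rw [add_comm m, hGs _ (by omega), map_smul]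
  refine ⟨hconj ε hερ, ?_, ?_, ?_, ?_, ?_⟩
  · exact (hgeom.mul_left Γ).of_nonneg_of_le
      (fun m => mul_nonneg (frobNorm_nonneg _) (by positivity)) hbound
  · have h := (hasSum_nat_add_iff' 1).2 hsum
    rw [Finset.sum_range_one, hG0] at h
    refine h.congr_fun fun m => ?_
    rw [hGs _ (by omega), map_smul]
  · rw [remainder, hrem.tsum_eq, ← hpart, map_sum]
    abel
  · have hg : HasSum (fun m : ℕ => Γ * θ ^ (n + 1) * θ ^ m) (Γ * θ ^ (n + 1) * (1 - θ)⁻¹) :=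
      (hasSum_geometric_of_lt_one hθ0 hθ1).mul_left _
    have h := tsum_of_norm_bounded hg (f := fun m : ℕ =>
      ((ε : ℂ) ^ (n + 1 + m)) • toHilbert (quasiCoeff n H₀ T (n + 1 + m))) fun m => by
        rw [norm_smul, norm_pow, Complex.norm_real, Real.norm_eq_abs, mul_comm, mul_assoc,
          ← pow_add]
        exact hbound (n + 1 + m)
    refine h.trans ?_
    -- The factor 2 of the remainder bound is the geometric sum at `θ ≤ 1/2`.
    have hinv : (1 - θ)⁻¹ ≤ 2 := by
      rw [inv_le_comm₀ (by linarith) (by norm_num)]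
      linarith
    calc Γ * θ ^ (n + 1) * (1 - θ)⁻¹ ≤ Γ * θ ^ (n + 1) * 2 := by gcongr
      _ = 2 * Γ * θ ^ (n + 1) := by ring
  · refine mem_closure_of_tendsto hsum.tendsto_sum_nat (Filter.Eventually.of_forall fun N => ?_)
    rw [← map_sum]
    -- The partial sum runs over `m < N`, and its terms have range `m + 1 ≤ N`.
    refine Set.mem_iUnion.2 ⟨N, _, Submodule.sum_mem _ fun m hm => ?_, rfl⟩
    exact rangeSpace_mono (Finset.mem_range.1 hm) (hGmem m)
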